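/- Let $S_0,S_1,V$ be finite-dimensional real vector spaces with nondegenerate (possibly indefinite) inner products $\langle\cdot,\cdot\rangle$, $|x|^2=\langle x,x\rangle$, with $\dim S_0=\dim S_1$, and let $S_0\times V\to S_1$, $(s,v)\mapsto s\cdot v=\mu_v(s)$, be a bilinear isometric map: $|s\cdot v|^2=|s|^2|v|^2$. Equivalently, the strictly upper triangular $3\times3$ matrices with entries $s_0\in S_0$, $s_1\in S_1$, $v\in V$ in positions $12$, $13$, $23$ form a special Nil-algebra $\mathscr N$. Define $s_1\cdot v^\flat\in S_0$ and $s_0^\flat\cdot s_1\in V$ by $\langle s_1\cdot v^\flat,q\rangle=\langle s_1,q\cdot v\rangle$ and $\langle s_0^\flat\cdot s_1,q\rangle=\langle s_1,s_0\cdot q\rangle$; together with $(x\cdot y)^\flat=y^\flat\cdot x^\flat$ and $x\cdot y^\flat=\langle x,y\rangle=x^\flat\cdot y$ for $x,y$ in the same one of these spaces, they define the matrix product of the Vinberg $T$-algebra of $\mathscr N$ (upper entries vectors, lower entries covectors, real diagonal). Write $M^*$ for the transpose of $M$ with $\flat$ applied to the off-diagonal entries, and let $$\mathscr H=\Big\{X=\begin{pmatrix}x_1&s_0&s_1\\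 s_0^\flat&x_2&v\\ s_1^\flat&v^\flat&x_3\end{pmatrix}\Big\}$$ be the space of Hermitian matrices. Let $G$ be the Vinberg group of upper triangular matrices with positive diagonal, $\det_G A=a_{11}a_{22}a_{33}$, $G_0=\{A\in G:\det_G A=1\}$ and $G_0^*=\{A^*:A\in G_0\}$. The groups $G$ and $G^*=\{A^*:A\in G\}$ act linearly on $\mathscr H$ by the representation $\rho$ that integrates $L_A(X)=A\cdot X+X\cdot A^*$ (explicitly, $\rho_A=\tfrac12(L_A^2-L_{A\cdot A})$). The special Vinberg cone is $\mathscr V=\{A\cdot A^*: A\in G\}\subset\mathscr H$. Put $$d(X)=x_1x_2x_3-x_1|v|^2-x_2|s_1|^2-x_3|s_0|^2+2\langle\mu_v(s_0),s_1\rangle,$$ $$d'(X)=d(X)+\frac{|s_0|^2|s_1|^2-\langle s_0^\flat\cdot s_1,\,s_0^\flat\cdot s_1\rangle}{x_1}\qquad(x_1\ne0).$$ (1) The functions $d$ and $d'$ are homogeneous of degree $3$ and satisfy $d(A\cdot A^*)=(\det_GA)^2=d'(A^*\cdot A)$ for $A\in G$. The cubic polynomial $d$ is $G_0$-invariant on $\mathscr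 H$, and the rational function $d'$ is $G_0^*$-invariant (its domain $x_1\neq 0$ being preserved by $G_0^*$). (2) Exclude the case $S_0=S_1=0\neq V$. Then $\mathscr V$ is self-adjoint if and only if $V$, $S_0$ and $S_1$ are isomorphic Euclidean vector spaces (i.e. their inner products are positive definite and the spaces are isometric to each other). Here $\mathscr V$ is called self-adjoint if there is a Euclidean inner product $B$ on $\mathscr H$ with $\{B(X,\cdot):X\in\mathscr V\}=\{\xi\in\mathscr H^*:\xi(Y)>0\text{ for all }Y\in\overline{\mathscr V}\setminus\{0\}\}$. Whenever $\mathscr V$ is self-adjoint (also in the excluded case), $d=d'$. -/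

import Mathlib

set_option linter.unusedSectionVars false
set_option linter.unusedSimpArgs false

/-- A special nil-algebra over `ℝ`: a nil-algebra of rank `3`, i.e. the algebra of strictly upper
triangular matrices with entries `N₁₂ = S₀`, `N₁₃ = S₁`, `N₂₃ = V` in real vector spaces with
nondegenerate (possibly indefinite) inner products, the product `N₁₂ × N₂₃ → N₁₃` being an
isometric map, and with `dim N₁₂ = dim N₁₃`.  In rank `3` associativity and the remaining axiom of
nil-algebras hold automatically, because `N · N₁₃ = 0` and all triple products vanish. -/
structure SpecialNilAlgebra (S₀ S₁ V : Type*) [AddCommGroup S₀] [Module ℝ S₀]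
    [AddCommGroup S₁] [Module ℝ S₁] [AddCommGroup V] [Module ℝ V] where
  g₀ : LinearMap.BilinForm ℝ S₀
  g₁ : LinearMap.BilinForm ℝ S₁
  gV : LinearMap.BilinForm ℝ V
  symm₀ : g₀.IsSymm
  symm₁ : g₁.IsSymm
  symmV : gV.IsSymm
  nondeg₀ : g₀.Nondegenerate
  nondeg₁ : g₁.Nondegenerate
  nondegV : gV.Nondegenerate
  /-- `s · v = μ_v(s)` -/
  mu : S₀ →ₗ[ℝ] V →ₗ[ℝ] S₁
  isometric : ∀ s v, g₁ (mu s v) (mu s v) = g₀ s s * gV v v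
  dim_eq : Module.finrank ℝ S₀ = Module.finrank ℝ S₁

/-- Matrices of the `T`-algebra of a special nil-algebra. An entry below the diagonal is a covector
`w^♭ = ⟨w, ·⟩`; it is stored as the vector `w`. -/
@[ext] structure TMat (S₀ S₁ V : Type*) where
  a11 : ℝ
  a12 : S₀
  a13 : S₁
  a21 : S₀
  a22 : ℝ
  a23 : V
  a31 : S₁
  a32 : V
  a33 : ℝ

namespace TMat

variable {S₀ S₁ V : Type*} [AddCommGroup S₀] [Module ℝ S₀]
    [AddCommGroup S₁] [Module ℝ S₁] [AddCommGroup V] [Module ℝ V]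

/-- The entries of a matrix as a tuple. -/
def equivProd (S₀ S₁ V : Type*) :
    TMat S₀ S₁ V ≃ ℝ × S₀ × S₁ × S₀ × ℝ × V × S₁ × V × ℝ where
  toFun M := (M.a11, M.a12, M.a13, M.a21, M.a22, M.a23, M.a31, M.a32, M.a33)
  invFun p := ⟨p.1, p.2.1, p.2.2.1, p.2.2.2.1, p.2.2.2.2.1, p.2.2.2.2.2.1, p.2.2.2.2.2.2.1,
    p.2.2.2.2.2.2.2.1, p.2.2.2.2.2.2.2.2⟩

instance : AddCommGroup (TMat S₀ S₁ V) := (equivProd S₀ S₁ V).addCommGroup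
instance : Module ℝ (TMat S₀ S₁ V) := (equivProd S₀ S₁ V).module ℝ

variable (M M' : TMat S₀ S₁ V) (c : ℝ)

@[simp] theorem add_a11 : (M + M').a11 = M.a11 + M'.a11 := rfl
@[simp] theorem add_a12 : (M + M').a12 = M.a12 + M'.a12 := rfl
@[simp] theorem add_a13 : (M + M').a13 = M.a13 + M'.a13 := rfl
@[simp] theorem add_a21 : (M + M').a21 = M.a21 + M'.a21 := rfl
@[simp] theorem add_a22 : (M + M').a22 = M.a22 + M'.a22 := rfl
@[simp] theorem add_a23 : (M + M').a23 = M.a23 + M'.a23 := rfl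
@[simp] theorem add_a31 : (M + M').a31 = M.a31 + M'.a31 := rfl
@[simp] theorem add_a32 : (M + M').a32 = M.a32 + M'.a32 := rfl
@[simp] theorem add_a33 : (M + M').a33 = M.a33 + M'.a33 := rfl
@[simp] theorem sub_a11 : (M - M').a11 = M.a11 - M'.a11 := rfl
@[simp] theorem sub_a12 : (M - M').a12 = M.a12 - M'.a12 := rfl
@[simp] theorem sub_a13 : (M - M').a13 = M.a13 - M'.a13 := rfl
@[simp] theorem sub_a21 : (M - M').a21 = M.a21 - M'.a21 := rfl
@[simp] theorem sub_a22 : (M - M').a22 = M.a22 - M'.a22 := rfl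
@[simp] theorem sub_a23 : (M - M').a23 = M.a23 - M'.a23 := rfl
@[simp] theorem sub_a31 : (M - M').a31 = M.a31 - M'.a31 := rfl
@[simp] theorem sub_a32 : (M - M').a32 = M.a32 - M'.a32 := rfl
@[simp] theorem sub_a33 : (M - M').a33 = M.a33 - M'.a33 := rfl
@[simp] theorem smul_a11 : (c • M).a11 = c * M.a11 := rfl
@[simp] theorem smul_a12 : (c • M).a12 = c • M.a12 := rfl
@[simp] theorem smul_a13 : (c • M).a13 = c • M.a13 := rfl
@[simp] theorem smul_a21 : (c • M).a21 = c • M.a21 := rfl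
@[simp] theorem smul_a22 : (c • M).a22 = c * M.a22 := rfl
@[simp] theorem smul_a23 : (c • M).a23 = c • M.a23 := rfl
@[simp] theorem smul_a31 : (c • M).a31 = c • M.a31 := rfl
@[simp] theorem smul_a32 : (c • M).a32 = c • M.a32 := rfl
@[simp] theorem smul_a33 : (c • M).a33 = c * M.a33 := rfl

/-- The identity matrix `I`. -/
def one : TMat S₀ S₁ V := ⟨1, 0, 0, 0, 1, 0, 0, 0, 1⟩

/-- `M^* = t(M^♭)`. -/
@[simps] def adj (M : TMat S₀ S₁ V) : TMat S₀ S₁ V :=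
  ⟨M.a11, M.a21, M.a31, M.a12, M.a22, M.a32, M.a13, M.a23, M.a33⟩

/-- The space `𝓗` of Hermitian matrices, `X^* = X`. -/
def herm (S₀ S₁ V : Type*) [AddCommGroup S₀] [Module ℝ S₀]
    [AddCommGroup S₁] [Module ℝ S₁] [AddCommGroup V] [Module ℝ V] :
    Submodule ℝ (TMat S₀ S₁ V) where
  carrier := {X | X.adj = X}
  add_mem' {X Y} hX hY := by
    change (X + Y).adj = X + Y
    calc (X + Y).adj = X.adj + Y.adj := rfl
      _ = X + Y := by rw [hX, hY]
  zero_mem' := rfl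
  smul_mem' c X hX := by
    change (c • X).adj = c • X
    calc (c • X).adj = c • X.adj := rfl
      _ = c • X := by rw [hX]

/-- The Solv-algebra: upper triangular matrices. -/
def IsUpper (A : TMat S₀ S₁ V) : Prop := A.a21 = 0 ∧ A.a31 = 0 ∧ A.a32 = 0

/-- The `G`-determinant: the product of the diagonal entries. -/
def detG (A : TMat S₀ S₁ V) : ℝ := A.a11 * A.a22 * A.a33

/-- The Vinberg group `G` (as a set of matrices). -/
def groupG (S₀ S₁ V : Type*) [AddCommGroup S₀] [AddCommGroup S₁] [AddCommGroup V] :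
    Set (TMat S₀ S₁ V) :=
  {A | A.a21 = 0 ∧ A.a31 = 0 ∧ A.a32 = 0 ∧ 0 < A.a11 ∧ 0 < A.a22 ∧ 0 < A.a33}

/-- The unimodular subgroup `G₀ = {A ∈ G | det_G A = 1}`. -/
def groupG0 (S₀ S₁ V : Type*) [AddCommGroup S₀] [AddCommGroup S₁] [AddCommGroup V] :
    Set (TMat S₀ S₁ V) :=
  {A | A ∈ groupG S₀ S₁ V ∧ A.detG = 1}

/-- The dual group `G₀^* = {A^* | A ∈ G₀}` of lower triangular matrices. -/
def groupG0Star (S₀ S₁ V : Type*) [AddCommGroup S₀] [AddCommGroup S₁] [AddCommGroup V] :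
    Set (TMat S₀ S₁ V) :=
  {B | ∃ A ∈ groupG0 S₀ S₁ V, B = A.adj}

end TMat

namespace SpecialNilAlgebra

open TMat

variable {S₀ S₁ V : Type*} [AddCommGroup S₀] [Module ℝ S₀] [FiniteDimensional ℝ S₀]
    [AddCommGroup S₁] [Module ℝ S₁] [FiniteDimensional ℝ S₁]
    [AddCommGroup V] [Module ℝ V] [FiniteDimensional ℝ V]
    (N : SpecialNilAlgebra S₀ S₁ V)

/-- The product `s₁ · v^♭ ∈ S₀`, determined by `⟨s₁ · v^♭, q⟩ = ⟨s₁, q · v⟩`. -/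
noncomputable def mulVFlat (s : S₁) (v : V) : S₀ :=
  (N.g₀.toDual N.nondeg₀).symm ((N.g₁ s).comp (N.mu.flip v))

/-- The product `s₀^♭ · s₁ ∈ V`, determined by `⟨s₀^♭ · s₁, q⟩ = ⟨s₁, s₀ · q⟩`. -/
noncomputable def flatMul (s₀ : S₀) (s₁ : S₁) : V :=
  (N.gV.toDual N.nondegV).symm ((N.g₁ s₁).comp (N.mu s₀))

theorem g₀_mulVFlat (s : S₁) (v : V) (q : S₀) :
    N.g₀ (N.mulVFlat s v) q = N.g₁ s (N.mu q v) := by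
  simp [mulVFlat]

theorem gV_flatMul (s₀ : S₀) (s₁ : S₁) (q : V) :
    N.gV (N.flatMul s₀ s₁) q = N.g₁ s₁ (N.mu s₀ q) := by
  simp [flatMul]

/-- The (non-associative) product of the `T`-algebra. The products involving covectors are given by
`x · y^♭ = ⟨x, y⟩ = x^♭ · y` (on the diagonal), by `mulVFlat`, `flatMul`, and by
`(x · y)^♭ = y^♭ · x^♭`. -/
@[simps] noncomputable def mul (M P : TMat S₀ S₁ V) : TMat S₀ S₁ V where
  a11 := M.a11 * P.a11 + N.g₀ M.a12 P.a21 + N.g₁ M.a13 P.a31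
  a12 := M.a11 • P.a12 + P.a22 • M.a12 + N.mulVFlat M.a13 P.a32
  a13 := M.a11 • P.a13 + N.mu M.a12 P.a23 + P.a33 • M.a13
  a21 := P.a11 • M.a21 + M.a22 • P.a21 + N.mulVFlat P.a31 M.a23
  a22 := N.g₀ M.a21 P.a12 + M.a22 * P.a22 + N.gV M.a23 P.a32
  a23 := N.flatMul M.a21 P.a13 + M.a22 • P.a23 + P.a33 • M.a23
  a31 := P.a11 • M.a31 + N.mu P.a21 M.a32 + M.a33 • P.a31
  a32 := N.flatMul P.a12 M.a31 + P.a22 • M.a32 + M.a33 • P.a32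
  a33 := N.g₁ M.a31 P.a13 + N.gV M.a32 P.a23 + M.a33 * P.a33

theorem mulVFlat_add_left (s s' : S₁) (v : V) :
    N.mulVFlat (s + s') v = N.mulVFlat s v + N.mulVFlat s' v := by
  simp [mulVFlat, LinearMap.add_comp]

theorem mulVFlat_add_right (s : S₁) (v v' : V) :
    N.mulVFlat s (v + v') = N.mulVFlat s v + N.mulVFlat s v' := by
  simp [mulVFlat, LinearMap.comp_add]

theorem mulVFlat_smul_left (c : ℝ) (s : S₁) (v : V) :
    N.mulVFlat (c • s) v = c • N.mulVFlat s v := by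
  simp [mulVFlat, LinearMap.smul_comp]

theorem mulVFlat_smul_right (c : ℝ) (s : S₁) (v : V) :
    N.mulVFlat s (c • v) = c • N.mulVFlat s v := by
  simp [mulVFlat, LinearMap.comp_smul]

theorem flatMul_add_left (s s' : S₀) (t : S₁) :
    N.flatMul (s + s') t = N.flatMul s t + N.flatMul s' t := by
  simp [flatMul, LinearMap.comp_add]

theorem flatMul_add_right (s : S₀) (t t' : S₁) :
    N.flatMul s (t + t') = N.flatMul s t + N.flatMul s t' := by
  simp [flatMul, LinearMap.add_comp]

theorem flatMul_smul_left (c : ℝ) (s : S₀) (t : S₁) :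
    N.flatMul (c • s) t = c • N.flatMul s t := by
  simp [flatMul, LinearMap.comp_smul]

theorem flatMul_smul_right (c : ℝ) (s : S₀) (t : S₁) :
    N.flatMul s (c • t) = c • N.flatMul s t := by
  simp [flatMul, LinearMap.smul_comp]

theorem mul_add (M P Q : TMat S₀ S₁ V) : N.mul M (P + Q) = N.mul M P + N.mul M Q := by
  ext <;> simp [mulVFlat_add_left, mulVFlat_add_right, flatMul_add_left, flatMul_add_right,
    add_smul] <;> first | ring | abel

theorem add_mul (M P Q : TMat S₀ S₁ V) : N.mul (M + P) Q = N.mul M Q + N.mul P Q := by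
  ext <;> simp [mulVFlat_add_left, mulVFlat_add_right, flatMul_add_left, flatMul_add_right,
    add_smul] <;> first | ring | abel

theorem mul_smul (c : ℝ) (M P : TMat S₀ S₁ V) : N.mul M (c • P) = c • N.mul M P := by
  ext <;> simp [mulVFlat_smul_left, mulVFlat_smul_right, flatMul_smul_left, flatMul_smul_right]
    <;> first | module | ring

theorem smul_mul (c : ℝ) (M P : TMat S₀ S₁ V) : N.mul (c • M) P = c • N.mul M P := by
  ext <;> simp [mulVFlat_smul_left, mulVFlat_smul_right, flatMul_smul_left, flatMul_smul_right]
    <;> first | module | ring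

theorem adj_mul (M P : TMat S₀ S₁ V) : (N.mul M P).adj = N.mul P.adj M.adj := by
  ext <;> simp [N.symm₀.eq, N.symm₁.eq, N.symmV.eq] <;> ring

/-- The Lie algebra representation `L_A(X) = A · X + X · A^*` on `𝓗`. -/
noncomputable def lieRep (A : TMat S₀ S₁ V) : herm S₀ S₁ V →ₗ[ℝ] herm S₀ S₁ V where
  toFun X := ⟨N.mul A X + N.mul X A.adj, by
    have hX : X.1.adj = X.1 := X.2
    change (N.mul A X.1 + N.mul X.1 A.adj).adj = _
    have h : (N.mul A X.1 + N.mul X.1 A.adj).adj =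
      (N.mul A X.1).adj + (N.mul X.1 A.adj).adj := rfl
    rw [h, adj_mul, adj_mul, hX, add_comm]; rfl⟩
  map_add' X Y := by
    apply Subtype.ext
    simp only [Submodule.coe_add, mul_add, add_mul]; abel
  map_smul' c X := by
    apply Subtype.ext
    simp only [SetLike.val_smul, mul_smul, smul_mul, smul_add, RingHom.id_apply]

/-- The linear action `ρ` on `𝓗` of the Vinberg group `G` and of the dual group `G^*`:
`ρ_A = ½ (L_A² - L_{A·A})`, which is `X ↦ A · X · A^*` whenever the products associate.
By `rho_mul_upper`, `rho_mul_lower` and `rho_one_add_smul` below this is the group representation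
which integrates the Lie algebra representation `A ↦ L_A`. -/
noncomputable def rho (A : TMat S₀ S₁ V) : herm S₀ S₁ V →ₗ[ℝ] herm S₀ S₁ V :=
  (1 / 2 : ℝ) • (N.lieRep A ∘ₗ N.lieRep A - N.lieRep (N.mul A A))

theorem herm_ext {X Y : herm S₀ S₁ V} (h11 : X.1.a11 = Y.1.a11) (h12 : X.1.a12 = Y.1.a12)
    (h13 : X.1.a13 = Y.1.a13) (h22 : X.1.a22 = Y.1.a22) (h23 : X.1.a23 = Y.1.a23)
    (h33 : X.1.a33 = Y.1.a33) : X = Y := by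
  have hX : X.1.adj = X.1 := X.2
  have hY : Y.1.adj = Y.1 := Y.2
  have e (M : TMat S₀ S₁ V) (h : M.adj = M) : M.a21 = M.a12 ∧ M.a31 = M.a13 ∧ M.a32 = M.a23 :=
    ⟨congrArg TMat.a12 h, congrArg TMat.a13 h, congrArg TMat.a23 h⟩
  obtain ⟨e1, e2, e3⟩ := e _ hX
  obtain ⟨f1, f2, f3⟩ := e _ hY
  apply Subtype.ext
  ext
  · exact h11
  · exact h12
  · exact h13
  · rw [e1, f1, h12]
  · exact h22
  · exact h23
  · rw [e2, f2, h13]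
  · rw [e3, f3, h23]
  · exact h33

theorem herm_lower (X : herm S₀ S₁ V) :
    X.1.a21 = X.1.a12 ∧ X.1.a31 = X.1.a13 ∧ X.1.a32 = X.1.a23 :=
  ⟨congrArg TMat.a12 X.2, congrArg TMat.a13 X.2, congrArg TMat.a23 X.2⟩

theorem ext₀ {x y : S₀} (h : ∀ q, N.g₀ x q = N.g₀ y q) : x = y :=
  (N.g₀.toDual N.nondeg₀).injective (LinearMap.ext fun q => h q)

theorem extV {x y : V} (h : ∀ q, N.gV x q = N.gV y q) : x = y :=
  (N.gV.toDual N.nondegV).injective (LinearMap.ext fun q => h q)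

/-- Polarization of the isometry condition. -/
theorem polar (s t : S₀) (v w : V) :
    N.g₁ (N.mu s v) (N.mu t w) + N.g₁ (N.mu s w) (N.mu t v) = 2 * N.g₀ s t * N.gV v w := by
  have h1 := N.isometric (s + t) (v + w)
  have h2 := N.isometric (s + t) v
  have h3 := N.isometric (s + t) w
  have h4 := N.isometric s (v + w)
  have h5 := N.isometric t (v + w)
  have a1 := N.isometric s v
  have a2 := N.isometric s w
  have a3 := N.isometric t v
  have a4 := N.isometric t w
  have c1 := N.symm₁.eq
  have c0 := N.symm₀.eq t s
  have cV := N.symmV.eq w v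
  have d1 := c1 (N.mu t w) (N.mu s v)
  have d2 := c1 (N.mu t v) (N.mu s w)
  have d3 := c1 (N.mu t v) (N.mu s v)
  have d4 := c1 (N.mu t w) (N.mu s w)
  have d5 := c1 (N.mu s w) (N.mu s v)
  have d6 := c1 (N.mu t w) (N.mu t v)
  simp only [map_add, LinearMap.add_apply] at *
  rw [d1, d2, d3, d4, d5, d6, c0, cV] at h1
  rw [d3, c0] at h2
  rw [d4, c0] at h3
  rw [d5, cV] at h4
  rw [d6, cV] at h5
  linarith

theorem mulVFlat_mu (t : S₀) (v w : V) :
    N.mulVFlat (N.mu t v) w + N.mulVFlat (N.mu t w) v = (2 * N.gV v w) • t := by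
  apply N.ext₀
  intro q
  have := N.polar t q v w
  simp [g₀_mulVFlat]
  linarith

theorem flatMul_mu (s t : S₀) (v : V) :
    N.flatMul s (N.mu t v) + N.flatMul t (N.mu s v) = (2 * N.g₀ s t) • v := by
  apply N.extV
  intro q
  have := N.polar s t v q
  have h2 := N.polar t s v q
  have := N.symm₀.eq t s
  have := N.symm₁.eq (N.mu t v) (N.mu s q)
  simp [gV_flatMul] at *
  linarith

theorem lieRep_add (A B : TMat S₀ S₁ V) : N.lieRep (A + B) = N.lieRep A + N.lieRep B := by
  ext1 X
  apply Subtype.ext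
  change N.mul (A + B) X + N.mul X (A.adj + B.adj) = (N.mul A X + N.mul X A.adj)
    + (N.mul B X + N.mul X B.adj)
  rw [add_mul, mul_add]; abel

theorem lieRep_smul (c : ℝ) (A : TMat S₀ S₁ V) : N.lieRep (c • A) = c • N.lieRep A := by
  ext1 X
  apply Subtype.ext
  change N.mul (c • A) X + N.mul X (c • A.adj) = c • (N.mul A X + N.mul X A.adj)
  rw [smul_mul, mul_smul, smul_add]

theorem mulVFlat_zero_left (v : V) : N.mulVFlat 0 v = 0 := by simp [mulVFlat]

theorem mulVFlat_zero_right (s : S₁) : N.mulVFlat s 0 = 0 := by simp [mulVFlat]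

theorem flatMul_zero_left (s : S₁) : N.flatMul 0 s = 0 := by simp [flatMul]

theorem flatMul_zero_right (s : S₀) : N.flatMul s 0 = 0 := by simp [flatMul]

theorem one_mul (M : TMat S₀ S₁ V) : N.mul one M = M := by
  ext <;> simp [one, mulVFlat_zero_left, mulVFlat_zero_right, flatMul_zero_left,
    flatMul_zero_right]

theorem mul_one (M : TMat S₀ S₁ V) : N.mul M one = M := by
  ext <;> simp [one, mulVFlat_zero_left, mulVFlat_zero_right, flatMul_zero_left,
    flatMul_zero_right]

theorem lieRep_one (X : herm S₀ S₁ V) : N.lieRep one X = (2 : ℝ) • X := by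
  apply Subtype.ext
  change N.mul one X + N.mul X one = (2 : ℝ) • (X : TMat S₀ S₁ V)
  rw [one_mul, mul_one, two_smul]

theorem rho_apply (A : TMat S₀ S₁ V) (X : herm S₀ S₁ V) :
    N.rho A X = (1 / 2 : ℝ) • (N.lieRep A (N.lieRep A X) - N.lieRep (N.mul A A) X) := rfl

/-- `ρ` is the identity at the identity matrix. -/
theorem rho_one (X : herm S₀ S₁ V) : N.rho one X = X := by
  simp only [rho_apply, one_mul, lieRep_one, map_smul]
  module

/-- `ρ` has differential `L` at the identity. -/
theorem rho_one_add_smul (A : TMat S₀ S₁ V) (c : ℝ) (X : herm S₀ S₁ V) :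
    N.rho (one + c • A) X = X + c • N.lieRep A X + c ^ 2 • N.rho A X := by
  simp only [rho_apply, add_mul, mul_add, smul_mul, mul_smul, one_mul, mul_one, lieRep_add,
    lieRep_smul, LinearMap.add_apply, LinearMap.smul_apply, map_add, map_smul, lieRep_one]
  module

/-- The entries of `ρ_A(X)` for upper triangular `A`. -/
theorem rho_upper (A : TMat S₀ S₁ V) (hA : A.IsUpper) (X : herm S₀ S₁ V) :
    (N.rho A X).1.a11 = A.a11 ^ 2 * X.1.a11 + X.1.a22 * N.g₀ A.a12 A.a12
        + X.1.a33 * N.g₁ A.a13 A.a13 + 2 * A.a11 * N.g₀ A.a12 X.1.a12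
        + 2 * A.a11 * N.g₁ A.a13 X.1.a13 + 2 * N.g₁ A.a13 (N.mu A.a12 X.1.a23) ∧
    (N.rho A X).1.a12 = (A.a11 * A.a22) • X.1.a12 + (A.a22 * X.1.a22) • A.a12
        + A.a11 • N.mulVFlat X.1.a13 A.a23 + N.mulVFlat (N.mu A.a12 X.1.a23) A.a23
        + A.a22 • N.mulVFlat A.a13 X.1.a23 + X.1.a33 • N.mulVFlat A.a13 A.a23 ∧
    (N.rho A X).1.a13 = (A.a33 * A.a11) • X.1.a13 + A.a33 • N.mu A.a12 X.1.a23
        + (A.a33 * X.1.a33) • A.a13 ∧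
    (N.rho A X).1.a22 = A.a22 ^ 2 * X.1.a22 + 2 * A.a22 * N.gV A.a23 X.1.a23
        + X.1.a33 * N.gV A.a23 A.a23 ∧
    (N.rho A X).1.a23 = (A.a33 * A.a22) • X.1.a23 + (A.a33 * X.1.a33) • A.a23 ∧
    (N.rho A X).1.a33 = A.a33 ^ 2 * X.1.a33 := by
  obtain ⟨h21, h31, h32⟩ := hA
  obtain ⟨x21, x31, x32⟩ := herm_lower X
  have p := N.mulVFlat_mu A.a12 A.a23 X.1.a23
  have p' : N.mulVFlat (N.mu A.a12 A.a23) X.1.a23 =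
    (2 * N.gV A.a23 X.1.a23) • A.a12 - N.mulVFlat (N.mu A.a12 X.1.a23) A.a23 :=
    eq_sub_of_add_eq p
  have c0 := fun x y => N.symm₀.eq x y
  have c1 := fun x y => N.symm₁.eq x y
  have cV := fun x y => N.symmV.eq x y
  rw [rho_apply]
  simp [lieRep, h21, h31, h32, x21, x31, x32, mulVFlat_zero_left, mulVFlat_zero_right,
    flatMul_zero_left, flatMul_zero_right, mulVFlat_add_left, mulVFlat_add_right,
    mulVFlat_smul_left, mulVFlat_smul_right, p']
  have q1 := N.g₀_mulVFlat A.a13 X.1.a23 A.a12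
  have q2 := N.g₀_mulVFlat X.1.a13 A.a23 A.a12
  have q3 := c0 A.a12 (N.mulVFlat A.a13 X.1.a23)
  have q4 := c0 A.a12 (N.mulVFlat X.1.a13 A.a23)
  rw [c0 X.1.a12 A.a12, c1 X.1.a13 A.a13, cV X.1.a23 A.a23, q3, q4, q1, q2,
    c1 X.1.a13 (N.mu A.a12 A.a23), c1 (N.mu A.a12 X.1.a23) A.a13]
  refine ⟨?_, ?_, ?_, ?_, ?_, ?_⟩
  · ring
  · module
  · module
  · ring
  · module
  · ring

/-- The entries of `ρ_B(X)` for lower triangular `B`. -/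
theorem rho_lower (B : TMat S₀ S₁ V) (hB : B.adj.IsUpper) (X : herm S₀ S₁ V) :
    (N.rho B X).1.a11 = B.a11 ^ 2 * X.1.a11 ∧
    (N.rho B X).1.a12 = (B.a11 * B.a22) • X.1.a12 + (B.a11 * X.1.a11) • B.a21 ∧
    (N.rho B X).1.a13 = (B.a33 * B.a11) • X.1.a13 + B.a11 • N.mu X.1.a12 B.a32
        + (B.a11 * X.1.a11) • B.a31 ∧
    (N.rho B X).1.a22 = B.a22 ^ 2 * X.1.a22 + 2 * B.a22 * N.g₀ B.a21 X.1.a12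
        + X.1.a11 * N.g₀ B.a21 B.a21 ∧
    (N.rho B X).1.a23 = (B.a22 * B.a33) • X.1.a23 + (B.a22 * X.1.a22) • B.a32
        + B.a33 • N.flatMul B.a21 X.1.a13 + B.a22 • N.flatMul X.1.a12 B.a31
        + X.1.a11 • N.flatMul B.a21 B.a31 + N.flatMul B.a21 (N.mu X.1.a12 B.a32) ∧
    (N.rho B X).1.a33 = B.a33 ^ 2 * X.1.a33 + X.1.a22 * N.gV B.a32 B.a32
        + X.1.a11 * N.g₁ B.a31 B.a31 + 2 * B.a33 * N.gV B.a32 X.1.a23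
        + 2 * B.a33 * N.g₁ B.a31 X.1.a13 + 2 * N.g₁ B.a31 (N.mu X.1.a12 B.a32) := by
  obtain ⟨h12, h13, h23⟩ := hB
  simp only [adj_a21, adj_a31, adj_a32] at h12 h13 h23
  obtain ⟨x21, x31, x32⟩ := herm_lower X
  have p := N.flatMul_mu X.1.a12 B.a21 B.a32
  have p' : N.flatMul X.1.a12 (N.mu B.a21 B.a32) =
    (2 * N.g₀ X.1.a12 B.a21) • B.a32 - N.flatMul B.a21 (N.mu X.1.a12 B.a32) :=
    eq_sub_of_add_eq p
  have c0 := fun x y => N.symm₀.eq x y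
  have c1 := fun x y => N.symm₁.eq x y
  have cV := fun x y => N.symmV.eq x y
  rw [rho_apply]
  simp [lieRep, h12, h13, h23, x21, x31, x32, mulVFlat_zero_left, mulVFlat_zero_right,
    flatMul_zero_left, flatMul_zero_right, flatMul_add_left, flatMul_add_right,
    flatMul_smul_left, flatMul_smul_right, p']
  have q1 := N.gV_flatMul X.1.a12 B.a31 B.a32
  have q2 := N.gV_flatMul B.a21 X.1.a13 B.a32
  have q3 := cV B.a32 (N.flatMul X.1.a12 B.a31)
  have q4 := cV B.a32 (N.flatMul B.a21 X.1.a13)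
  rw [c0 X.1.a12 B.a21, c1 X.1.a13 B.a31, cV X.1.a23 B.a32, q3, q4, q1, q2,
    c1 X.1.a13 (N.mu B.a21 B.a32), c1 (N.mu X.1.a12 B.a32) B.a31]
  refine ⟨?_, ?_, ?_, ?_, ?_, ?_⟩
  · ring
  · module
  · module
  · ring
  · module
  · ring

/-- `ρ` is multiplicative on upper triangular matrices. -/
theorem rho_mul_upper (A B : TMat S₀ S₁ V) (hA : A.IsUpper) (hB : B.IsUpper)
    (X : herm S₀ S₁ V) : N.rho (N.mul A B) X = N.rho A (N.rho B X) := by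
  have hAB : (N.mul A B).IsUpper := by
    obtain ⟨a1, a2, a3⟩ := hA
    obtain ⟨b1, b2, b3⟩ := hB
    refine ⟨?_, ?_, ?_⟩ <;> simp [a1, a2, a3, b1, b2, b3, mulVFlat_zero_left,
      flatMul_zero_right]
  obtain ⟨e1, e2, e3, e4, e5, e6⟩ := N.rho_upper _ hAB X
  obtain ⟨f1, f2, f3, f4, f5, f6⟩ := N.rho_upper _ hA (N.rho B X)
  obtain ⟨k1, k2, k3, k4, k5, k6⟩ := N.rho_upper _ hB X
  obtain ⟨a1, a2, a3⟩ := hA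
  obtain ⟨b1, b2, b3⟩ := hB
  have c0 := fun x y => N.symm₀.eq x y
  have c1 := fun x y => N.symm₁.eq x y
  have cV := fun x y => N.symmV.eq x y
  apply herm_ext
  · rw [e1, f1, k1, k2, k3, k4, k5, k6]
    simp [b1, b2, b3, a1, a2, a3, mulVFlat_zero_right]
    simp only [c0 A.a12 (N.mulVFlat _ _), g₀_mulVFlat]
    rw [c0 B.a12 A.a12, c1 B.a13 A.a13, c1 (N.mu A.a12 B.a23) B.a13,
      c1 (N.mu A.a12 B.a23) A.a13, c1 X.1.a13 (N.mu A.a12 B.a23),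
      c1 (N.mu B.a12 X.1.a23) (N.mu A.a12 B.a23)]
    have i1 := N.isometric A.a12 B.a23
    have i2 := N.polar A.a12 A.a12 B.a23 X.1.a23
    rw [c1 (N.mu A.a12 X.1.a23)] at i2
    linear_combination X.1.a33 * i1 + B.a22 * i2
  · rw [e2, f2, k2, k3, k4, k5, k6]
    simp [b1, b2, b3, a1, a2, a3, mulVFlat_zero_right, flatMul_zero_left, mulVFlat_add_left,
      mulVFlat_add_right, mulVFlat_smul_left, mulVFlat_smul_right]
    have i1 := N.mulVFlat_mu A.a12 B.a23 B.a23
    have i2 := N.mulVFlat_mu A.a12 B.a23 X.1.a23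
    linear_combination (norm := module) (X.1.a33 * A.a22 / 2) • i1 + (A.a22 * B.a22) • i2
  · rw [e3, f3, k3, k5, k6]
    simp [b1, b2, b3, a1, a2, a3, mulVFlat_zero_right, flatMul_zero_left]
    module
  · rw [e4, f4, k4, k5, k6]
    simp [b1, b2, b3, a1, a2, a3, flatMul_zero_left]
    rw [cV A.a23 B.a23]
    ring
  · rw [e5, f5, k5, k6]
    simp [b1, b2, b3, a1, a2, a3, flatMul_zero_left]
    module
  · rw [e6, f6, k6]
    simp [b1, b2, b3, a1, a2, a3]
    ring

/-- `ρ` is multiplicative on lower triangular matrices. -/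
theorem rho_mul_lower (A B : TMat S₀ S₁ V) (hA : A.adj.IsUpper) (hB : B.adj.IsUpper)
    (X : herm S₀ S₁ V) : N.rho (N.mul A B) X = N.rho A (N.rho B X) := by
  have hAB : (N.mul A B).adj.IsUpper := by
    obtain ⟨a1, a2, a3⟩ := hA
    obtain ⟨b1, b2, b3⟩ := hB
    simp only [adj_a21, adj_a31, adj_a32] at a1 a2 a3 b1 b2 b3
    refine ⟨?_, ?_, ?_⟩ <;> simp [a1, a2, a3, b1, b2, b3, mulVFlat_zero_left,
      flatMul_zero_right]
  obtain ⟨e1, e2, e3, e4, e5, e6⟩ := N.rho_lower _ hAB X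
  obtain ⟨f1, f2, f3, f4, f5, f6⟩ := N.rho_lower _ hA (N.rho B X)
  obtain ⟨k1, k2, k3, k4, k5, k6⟩ := N.rho_lower _ hB X
  obtain ⟨a1, a2, a3⟩ := hA
  obtain ⟨b1, b2, b3⟩ := hB
  simp only [adj_a21, adj_a31, adj_a32] at a1 a2 a3 b1 b2 b3
  have c0 := fun x y => N.symm₀.eq x y
  have c1 := fun x y => N.symm₁.eq x y
  have cV := fun x y => N.symmV.eq x y
  apply herm_ext
  · rw [e1, f1, k1]
    simp [b1, b2, b3, a1, a2, a3, mulVFlat_zero_right, flatMul_zero_left]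
    ring
  · rw [e2, f2, k1, k2]
    simp [b1, b2, b3, a1, a2, a3, mulVFlat_zero_right, flatMul_zero_left]
    module
  · rw [e3, f3, k1, k2, k3]
    simp [b1, b2, b3, a1, a2, a3, mulVFlat_zero_right, flatMul_zero_left]
    module
  · rw [e4, f4, k1, k2, k4]
    simp [b1, b2, b3, a1, a2, a3, mulVFlat_zero_right, flatMul_zero_left]
    rw [c0 B.a21 A.a21]
    ring
  · rw [e5, f5, k1, k2, k3, k4, k5]
    simp [b1, b2, b3, a1, a2, a3, mulVFlat_zero_right, flatMul_zero_left, flatMul_add_left,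
      flatMul_add_right, flatMul_smul_left, flatMul_smul_right]
    have i1 := N.flatMul_mu B.a21 B.a21 A.a32
    have i2 := N.flatMul_mu B.a21 X.1.a12 A.a32
    linear_combination (norm := module) (X.1.a11 * A.a22 / 2) • i1 + (A.a22 * B.a22) • i2
  · rw [e6, f6, k1, k2, k3, k4, k5, k6]
    simp [b1, b2, b3, a1, a2, a3, mulVFlat_zero_right, flatMul_zero_left]
    simp only [cV A.a32 (N.flatMul _ _), gV_flatMul]
    rw [cV B.a32 A.a32, c1 B.a31 A.a31, c1 (N.mu B.a21 A.a32) A.a31,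
      c1 (N.mu B.a21 A.a32) B.a31, c1 (N.mu B.a21 A.a32) X.1.a13,
      c1 (N.mu B.a21 A.a32) (N.mu X.1.a12 B.a32)]
    have i1 := N.isometric B.a21 A.a32
    have i2 := N.polar B.a21 X.1.a12 A.a32 A.a32
    linear_combination X.1.a11 * i1 + B.a22 * i2

/-- The special Vinberg cone `𝓥 = {A · A^* | A ∈ G} ⊆ 𝓗`. -/
def cone : Set (herm S₀ S₁ V) :=
  {X | ∃ A ∈ groupG S₀ S₁ V, (X : TMat S₀ S₁ V) = N.mul A A.adj}

/-- The cubic polynomial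
`d(X) = x₁x₂x₃ - x₁|v|² - x₂|s₁|² - x₃|s₀|² + 2⟨μ_v(s₀), s₁⟩`. -/
def d (X : herm S₀ S₁ V) : ℝ :=
  X.1.a11 * X.1.a22 * X.1.a33 - X.1.a11 * N.gV X.1.a23 X.1.a23
    - X.1.a22 * N.g₁ X.1.a13 X.1.a13 - X.1.a33 * N.g₀ X.1.a12 X.1.a12
    + 2 * N.g₁ (N.mu X.1.a12 X.1.a23) X.1.a13

/-- The rational function
`d'(X) = d(X) + (|s₀|²|s₁|² - ⟨s₀^♭·s₁, s₀^♭·s₁⟩) / x₁`, defined where `x₁ ≠ 0`. -/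
noncomputable def d' (X : herm S₀ S₁ V) : ℝ :=
  N.d X + (N.g₀ X.1.a12 X.1.a12 * N.g₁ X.1.a13 X.1.a13
    - N.gV (N.flatMul X.1.a12 X.1.a13) (N.flatMul X.1.a12 X.1.a13)) / X.1.a11

/-- `V`, `S₀` and `S₁` are isomorphic Euclidean vector spaces. -/
def IsomorphicEuclidean {S₀ S₁ V : Type*} [AddCommGroup S₀] [Module ℝ S₀]
    [AddCommGroup S₁] [Module ℝ S₁] [AddCommGroup V] [Module ℝ V]
    (N : SpecialNilAlgebra S₀ S₁ V) : Prop :=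
  N.gV.toQuadraticMap.PosDef ∧ N.g₀.toQuadraticMap.PosDef ∧ N.g₁.toQuadraticMap.PosDef ∧
    N.gV.toQuadraticMap.Equivalent N.g₀.toQuadraticMap ∧
    N.g₀.toQuadraticMap.Equivalent N.g₁.toQuadraticMap

end SpecialNilAlgebra

/-- The adjoint cone of a subset `C` of a finite dimensional real vector space (with its canonical
topology): the linear forms that are positive on `closure C` minus the origin. -/
def adjointCone {E : Type*} [AddCommGroup E] [Module ℝ E] (C : Set E) :
    Set (Module.Dual ℝ E) :=
  {ξ | ∀ x ∈ @closure E (moduleTopology ℝ E) C, x ≠ 0 → 0 < ξ x}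

/-- `C` is self-adjoint: `C^* = ⟨C, ·⟩` for some Euclidean inner product. -/
def IsSelfAdjointCone {E : Type*} [AddCommGroup E] [Module ℝ E] (C : Set E) : Prop :=
  ∃ B : LinearMap.BilinForm ℝ E, B.IsSymm ∧ B.toQuadraticMap.PosDef ∧
    adjointCone C = (fun x => B x) '' C

namespace SpecialNilAlgebra

open TMat

variable {S₀ S₁ V : Type*} [AddCommGroup S₀] [Module ℝ S₀] [FiniteDimensional ℝ S₀]
    [AddCommGroup S₁] [Module ℝ S₁] [FiniteDimensional ℝ S₁]
    [AddCommGroup V] [Module ℝ V] [FiniteDimensional ℝ V]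
    (N : SpecialNilAlgebra S₀ S₁ V)

/-! ### Adjoints of the isometric map -/

/-! Both invariance statements rest on completing squares. With `dim S₀ = dim S₁` the adjoint `s₁ ↦
s₁ · v^♭` satisfies the same norm identity as `μ_v` (`norm_mulVFlat`), even for isotropic `v`; this
makes the cubic `d` a relative invariant of the upper triangular matrices (`d_rho`). For lower
triangular matrices the other adjoint `s₀^♭ · s₁` enters. Its norm need not be multiplicative, and
the defect is exactly the rational term of `d'`; the identity `a11_mul_d'` writes `x₁ d'` as a `2 ×
2` determinant, whence `d'_rho`. The values on `A · A^*` and `A^* · A` follow by acting on the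
identity matrix.

Suppose that a form `B` makes the cone self-adjoint. The adjoint cone is then nonempty, and a linear
form positive on the orbits of the diagonal units forces all three inner products to be positive
definite (`isEuclidean_of_adjointCone_nonempty`). Then `dim V ≤ dim S₀` if `S₀ ≠ 0`, since `μ(s, ·)`
is injective for `s ≠ 0`. The reverse inequality compares faces. The forms `ξ_s(X) = ρ_U(X)₁₁`, with
`U` unipotent with entry `s` in position `12`, span extreme rays of the dual cone, so `B` matches
each of them with a multiple of a transform of a diagonal unit (`exists_smul_rho_a11`). In the cone,
the face where `ξ_s` vanishes lies in a space of dimension `dim V + 2`. If the matching element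
comes from the second or third unit, the dual forms vanishing on it span at least `dim S₁ + 2` or
`dim S₀ + 2` dimensions, so `dim S₀ ≤ dim V` (`finrank_le`). If it were the first unit for every
`s`, all the `ξ_s` would be proportional, which is false. With equal dimensions, `μ(s, ·)` and `μ(·,
v)` are similarities, and rescaling gives the isometries.

Conversely, for isomorphic Euclidean spaces `s₀^♭ · s₁` has multiplicative norm as well, so `d =
d'`. The trace form then works: `⟨A^* · A, X⟩ = tr ρ_A(X)` is positive on the closed cone without
the origin, elements of the cone also have the form `A^* · A` (`exists_eq_adj_mul`), and a positive
form is represented by a matrix with positive minors, hence by an element of the cone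
(`mem_cone_of_pos`). -/

theorem mulVFlat_mu_self (s : S₀) (q : V) :
    N.mulVFlat (N.mu s q) q = N.gV q q • s := by
  have h := N.mulVFlat_mu s q q
  linear_combination (norm := module) (1 / 2 : ℝ) • h

theorem flatMul_mu_self (s : S₀) (q : V) :
    N.flatMul s (N.mu s q) = N.g₀ s s • q := by
  have h := N.flatMul_mu s s q
  linear_combination (norm := module) (1 / 2 : ℝ) • h

/-- Up to the factor `|q|²`, the adjoint of `μ_q` is a left inverse of `μ_q`. So `μ_q` is injective,
equality of dimensions makes it surjective, and the identity need only be checked on its image. -/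
theorem norm_mulVFlat_of_ne_zero (p : S₁) {q : V} (hq : N.gV q q ≠ 0) :
    N.g₀ (N.mulVFlat p q) (N.mulVFlat p q) = N.g₁ p p * N.gV q q := by
  have hinj : Function.Injective (N.mu.flip q) := by
    rw [← LinearMap.ker_eq_bot, LinearMap.ker_eq_bot']
    intro s hs
    have h := N.mulVFlat_mu_self s q
    have hs' : N.mu s q = 0 := hs
    rw [hs', mulVFlat_zero_left] at h
    exact (smul_eq_zero.1 h.symm).resolve_left hq
  obtain ⟨s, hs⟩ :=
    (LinearMap.injective_iff_surjective_of_finrank_eq_finrank N.dim_eq).1 hinj p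
  have hs' : N.mu s q = p := hs
  rw [← hs', mulVFlat_mu_self, N.isometric]
  simp only [map_smul, LinearMap.smul_apply, smul_eq_mul]
  ring

/-- If every vector were isotropic, polarization would make the form vanish, against nondegeneracy.
-/
theorem exists_gV_self_ne_zero {q : V} (hq : q ≠ 0) : ∃ r, N.gV r r ≠ 0 := by
  by_contra! h
  refine hq (N.extV fun r => ?_)
  have h1 := h (q + r)
  have h2 := N.symmV.eq r q
  simp only [map_add, LinearMap.add_apply, h, h2] at h1
  simp only [map_zero, LinearMap.zero_apply]
  linarith

/-- Because `dim S₀ = dim S₁`, the adjoint of the isometric map is isometric. -/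
theorem norm_mulVFlat (p : S₁) (q : V) :
    N.g₀ (N.mulVFlat p q) (N.mulVFlat p q) = N.g₁ p p * N.gV q q := by
  by_cases hq : q = 0
  · simp [hq, mulVFlat_zero_right]
  obtain ⟨r, hr⟩ := N.exists_gV_self_ne_zero hq
  by_cases hq0 : N.gV q q = 0
  swap
  · exact N.norm_mulVFlat_of_ne_zero p hq0
  have c := N.symmV.eq q r
  obtain ⟨t, ht1, ht2⟩ : ∃ t : ℝ, N.gV (q + t • r) (q + t • r) ≠ 0 ∧
      N.gV (q - t • r) (q - t • r) ≠ 0 := by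
    -- For isotropic `q`, `|q ± t r|² = t (t|r|² ± 2⟨q, r⟩)`. This `t` makes `t|r|² = 2|⟨q, r⟩| +
    -- 1`, which dominates the cross term for either sign.
    refine ⟨(2 * |N.gV q r| + 1) / N.gV r r, ?_⟩
    have ht : (2 * |N.gV q r| + 1) / N.gV r r * N.gV r r = 2 * |N.gV q r| + 1 :=
      div_mul_cancel₀ _ hr
    have h0 := abs_nonneg (N.gV q r)
    have ht0 : (2 * |N.gV q r| + 1) / N.gV r r ≠ 0 := div_ne_zero (by positivity) hr
    generalize (2 * |N.gV q r| + 1) / N.gV r r = t at ht ht0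
    have h1 := le_abs_self (N.gV q r)
    have h2 := neg_abs_le (N.gV q r)
    have e1 : N.gV (q + t • r) (q + t • r) = t * (2 * N.gV q r + t * N.gV r r) := by
      simp [hq0, c]; ring
    have e2 : N.gV (q - t • r) (q - t • r) = t * (t * N.gV r r - 2 * N.gV q r) := by
      simp [hq0, c]; ring
    rw [e1, e2]
    exact ⟨mul_ne_zero ht0 (by linarith), mul_ne_zero ht0 (by linarith)⟩
  have h1 := N.norm_mulVFlat_of_ne_zero p ht1
  have h2 := N.norm_mulVFlat_of_ne_zero p ht2
  have h3 := N.norm_mulVFlat_of_ne_zero p hr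
  have hsub : N.mulVFlat p (q - t • r) = N.mulVFlat p q - t • N.mulVFlat p r := by
    rw [sub_eq_add_neg, ← neg_smul, mulVFlat_add_right, mulVFlat_smul_right]; module
  rw [hsub] at h2
  rw [mulVFlat_add_right, mulVFlat_smul_right] at h1
  simp only [map_add, map_sub, LinearMap.add_apply, LinearMap.sub_apply, map_smul,
    LinearMap.smul_apply, smul_eq_mul] at h1 h2
  -- Both sides are quadratic in the second argument; adding the identities at `q + t r` and `q - t
  -- r` cancels the cross terms.
  linear_combination (1 / 2 : ℝ) * h1 + (1 / 2 : ℝ) * h2 - t ^ 2 * h3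

/-- Polarization of `norm_mulVFlat` in the first argument. -/
theorem g₀_mulVFlat_mulVFlat_left (p p' : S₁) (q : V) :
    N.g₀ (N.mulVFlat p q) (N.mulVFlat p' q) = N.g₁ p p' * N.gV q q := by
  have h := N.norm_mulVFlat (p + p') q
  have h1 := N.norm_mulVFlat p q
  have h2 := N.norm_mulVFlat p' q
  have c0 := N.symm₀.eq (N.mulVFlat p q) (N.mulVFlat p' q)
  have c1 := N.symm₁.eq p p'
  simp only [mulVFlat_add_left, map_add, LinearMap.add_apply] at h c0 c1
  rw [← c0, ← c1] at h
  linarith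

/-- Polarization of `norm_mulVFlat` in the second argument. -/
theorem g₀_mulVFlat_mulVFlat_right (p : S₁) (q r : V) :
    N.g₀ (N.mulVFlat p q) (N.mulVFlat p r) = N.g₁ p p * N.gV q r := by
  have h := N.norm_mulVFlat p (q + r)
  have h1 := N.norm_mulVFlat p q
  have h2 := N.norm_mulVFlat p r
  have c0 := N.symm₀.eq (N.mulVFlat p q) (N.mulVFlat p r)
  have c1 := N.symmV.eq q r
  simp only [mulVFlat_add_right, map_add, LinearMap.add_apply] at h c0 c1
  rw [← c0, ← c1] at h
  linarith

/-- Polarization of `norm_mulVFlat` in both arguments. -/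
theorem g₀_mulVFlat_mulVFlat_add (p p' : S₁) (q r : V) :
    N.g₀ (N.mulVFlat p q) (N.mulVFlat p' r) + N.g₀ (N.mulVFlat p r) (N.mulVFlat p' q) =
      2 * N.g₁ p p' * N.gV q r := by
  have h := N.g₀_mulVFlat_mulVFlat_left p p' (q + r)
  have h1 := N.g₀_mulVFlat_mulVFlat_left p p' q
  have h2 := N.g₀_mulVFlat_mulVFlat_left p p' r
  have c1 := N.symmV.eq q r
  simp only [mulVFlat_add_right, map_add, LinearMap.add_apply] at h c1
  rw [← c1] at h
  linarith

theorem g₁_mu (s : S₀) (v : V) (t : S₁) : N.g₁ (N.mu s v) t = N.g₀ s (N.mulVFlat t v) := by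
  have c1 := N.symm₁.eq (N.mu s v) t
  have c0 := N.symm₀.eq s (N.mulVFlat t v)
  rw [c1, c0, g₀_mulVFlat]

/-! ### The action on the determinants -/

/-- The identity matrix as a Hermitian matrix. -/
def hermOne (S₀ S₁ V : Type*) [AddCommGroup S₀] [Module ℝ S₀]
    [AddCommGroup S₁] [Module ℝ S₁] [AddCommGroup V] [Module ℝ V] : herm S₀ S₁ V :=
  ⟨one, rfl⟩

/-- The upper triangular matrices with unit diagonal. -/
def unip (s : S₀) (p : S₁) (q : V) : TMat S₀ S₁ V := ⟨1, s, p, 0, 1, q, 0, 0, 1⟩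

/-- Diagonal matrices. -/
def diag (S₀ S₁ V : Type*) [AddCommGroup S₀] [AddCommGroup S₁] [AddCommGroup V] (a b c : ℝ) :
    TMat S₀ S₁ V := ⟨a, 0, 0, 0, b, 0, 0, 0, c⟩

theorem isUpper_of_mem_groupG {A : TMat S₀ S₁ V} (hA : A ∈ groupG S₀ S₁ V) : A.IsUpper :=
  ⟨hA.1, hA.2.1, hA.2.2.1⟩

theorem isUpper_unip (s : S₀) (p : S₁) (q : V) : (unip s p q).IsUpper := ⟨rfl, rfl, rfl⟩

theorem isUpper_diag (a b c : ℝ) : (diag S₀ S₁ V a b c).IsUpper := ⟨rfl, rfl, rfl⟩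

/-- No associativity is needed: `L_A L_A I = A(A + A^*) + (A + A^*)A^*` and `L_{A·A} I = A·A +
A^*·A^*`, so half the difference is `A · A^*`. -/
theorem rho_hermOne (A : TMat S₀ S₁ V) :
    (N.rho A (hermOne S₀ S₁ V) : TMat S₀ S₁ V) = N.mul A A.adj := by
  have e : ∀ B : TMat S₀ S₁ V, (N.lieRep B (hermOne S₀ S₁ V) : TMat S₀ S₁ V) = B + B.adj :=
    fun B => by
      change N.mul B one + N.mul one B.adj = _
      rw [mul_one, one_mul]
  have e2 : (N.lieRep A (N.lieRep A (hermOne S₀ S₁ V)) : TMat S₀ S₁ V) =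
      N.mul A (A + A.adj) + N.mul (A + A.adj) A.adj := by
    rw [← e]; rfl
  rw [rho_apply]
  simp only [Submodule.coe_smul, AddSubgroupClass.coe_sub, e, e2, mul_add, add_mul, adj_mul]
  module

/-- This factorization reduces the invariance of `d` to three elementary kinds of matrices. -/
theorem unip_mul_unip_mul_diag {A : TMat S₀ S₁ V} (hA : A.IsUpper) (h2 : A.a22 ≠ 0)
    (h3 : A.a33 ≠ 0) :
    N.mul (unip 0 (A.a33⁻¹ • A.a13) (A.a33⁻¹ • A.a23)) (N.mul (unip (A.a22⁻¹ • A.a12) 0 0)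
      (diag S₀ S₁ V A.a11 A.a22 A.a33)) = A := by
  obtain ⟨e1, e2, e3⟩ := hA
  ext <;> simp [unip, diag, mulVFlat_zero_left, mulVFlat_zero_right, flatMul_zero_left,
    flatMul_zero_right, smul_smul, h2, h3, e1, e2, e3]

theorem d_rho_diag (a b c : ℝ) (X : herm S₀ S₁ V) :
    N.d (N.rho (diag S₀ S₁ V a b c) X) = (a * b * c) ^ 2 * N.d X := by
  obtain ⟨e1, e2, e3, e4, e5, e6⟩ := N.rho_upper _ (isUpper_diag a b c) X
  rw [d, e1, e2, e3, e4, e5, e6]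
  simp [diag, d, mulVFlat_zero_left, mulVFlat_zero_right]
  ring

theorem d_rho_unip_left (s : S₀) (X : herm S₀ S₁ V) :
    N.d (N.rho (unip s 0 0) X) = N.d X := by
  obtain ⟨e1, e2, e3, e4, e5, e6⟩ := N.rho_upper _ (isUpper_unip s 0 0) X
  have c0 := N.symm₀.eq X.1.a12 s
  have c1 := N.symm₁.eq X.1.a13 (N.mu s X.1.a23)
  have c1' := N.symm₁.eq (N.mu X.1.a12 X.1.a23) (N.mu s X.1.a23)
  have i1 := N.isometric s X.1.a23
  have i2 := N.polar s X.1.a12 X.1.a23 X.1.a23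
  rw [d, e1, e2, e3, e4, e5, e6]
  simp [unip, d, mulVFlat_zero_left, mulVFlat_zero_right]
  rw [c0, c1, ← c1'] at *
  linear_combination (X.1.a22) * i1 + i2

/-- Here the invariance needs the polarized identities for the adjoint map, hence the equality of
dimensions; the other unipotent factor only needs the isometry of `μ`. -/
theorem d_rho_unip_right (p : S₁) (q : V) (X : herm S₀ S₁ V) :
    N.d (N.rho (unip 0 p q) X) = N.d X := by
  obtain ⟨e1, e2, e3, e4, e5, e6⟩ := N.rho_upper _ (isUpper_unip 0 p q) X
  have c0 := fun x y => N.symm₀.eq x y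
  have c1 := N.symm₁.eq X.1.a13 p
  have cV := N.symmV.eq X.1.a23 q
  rw [d, e1, e2, e3, e4, e5, e6]
  simp only [unip, d, map_add, map_zero, map_smul, LinearMap.add_apply, LinearMap.zero_apply,
    LinearMap.smul_apply, smul_eq_mul, mulVFlat_zero_left, smul_zero, g₁_mu, mulVFlat_add_left,
    mulVFlat_smul_left, mulVFlat_add_right, mulVFlat_smul_right]
  generalize X.1.a13 = s at *
  generalize X.1.a23 = v at *
  have r1 := N.norm_mulVFlat s q
  have r2 := N.g₀_mulVFlat_mulVFlat_left s p q
  have r3 := N.norm_mulVFlat p v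
  have r4 := N.g₀_mulVFlat_mulVFlat_right s q v
  have r5 := N.g₀_mulVFlat_mulVFlat_left p s v
  have r6 := N.g₀_mulVFlat_mulVFlat_right p q v
  have r7 := N.norm_mulVFlat p q
  have r8 := eq_sub_of_add_eq (N.g₀_mulVFlat_mulVFlat_add p s q v)
  rw [c0 (N.mulVFlat p v) (N.mulVFlat p q), c0 (N.mulVFlat p v) (N.mulVFlat s q),
    c0 (N.mulVFlat p q) (N.mulVFlat s q), c0 (N.mulVFlat s q) X.1.a12,
    c0 (N.mulVFlat p q) X.1.a12, c0 (N.mulVFlat p v) X.1.a12, c1, cV, r1, r2, r3, r4, r5, r6, r7]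
  rw [c0 (N.mulVFlat p v) (N.mulVFlat s q)] at r8
  rw [r8, c1]
  ring

/-- `d` is a relative invariant of the group of upper triangular matrices. -/
theorem d_rho {A : TMat S₀ S₁ V} (hA : A.IsUpper) (h2 : A.a22 ≠ 0) (h3 : A.a33 ≠ 0)
    (X : herm S₀ S₁ V) : N.d (N.rho A X) = A.detG ^ 2 * N.d X := by
  have h := N.unip_mul_unip_mul_diag hA h2 h3
  have hQ : (N.mul (unip (A.a22⁻¹ • A.a12) 0 0) (diag S₀ S₁ V A.a11 A.a22 A.a33)).IsUpper := by
    refine ⟨?_, ?_, ?_⟩ <;> simp [unip, diag, mulVFlat_zero_left, flatMul_zero_left,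
      flatMul_zero_right]
  conv_lhs => rw [← h]
  rw [N.rho_mul_upper _ _ (isUpper_unip _ _ _) hQ,
    N.rho_mul_upper _ _ (isUpper_unip _ _ _) (isUpper_diag _ _ _), d_rho_unip_right,
    d_rho_unip_left, d_rho_diag, detG]

/-- Eliminating the first row and column leaves a `2 × 2` block. The rational term of `d'` is what
completes its determinant. -/
theorem a11_mul_d' (X : herm S₀ S₁ V) (h : X.1.a11 ≠ 0) :
    X.1.a11 * N.d' X = (X.1.a11 * X.1.a22 - N.g₀ X.1.a12 X.1.a12) *
      (X.1.a11 * X.1.a33 - N.g₁ X.1.a13 X.1.a13) -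
      N.gV (X.1.a11 • X.1.a23 - N.flatMul X.1.a12 X.1.a13)
        (X.1.a11 • X.1.a23 - N.flatMul X.1.a12 X.1.a13) := by
  have c1 := N.symm₁.eq X.1.a13 (N.mu X.1.a12 X.1.a23)
  have cV := N.symmV.eq X.1.a23 (N.flatMul X.1.a12 X.1.a13)
  rw [d', _root_.mul_add, mul_div_cancel₀ _ h, d]
  simp only [map_sub, LinearMap.sub_apply, map_smul, LinearMap.smul_apply, smul_eq_mul, cV,
    gV_flatMul, c1]
  ring

/-- `d'` is a relative invariant of the group of lower triangular matrices. -/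
theorem d'_rho {B : TMat S₀ S₁ V} (hB : B.adj.IsUpper) (h1 : B.a11 ≠ 0)
    (X : herm S₀ S₁ V) (hX : X.1.a11 ≠ 0) :
    (N.rho B X).1.a11 ≠ 0 ∧ N.d' (N.rho B X) = B.detG ^ 2 * N.d' X := by
  obtain ⟨e1, e2, e3, e4, e5, e6⟩ := N.rho_lower B hB X
  have h11 : (N.rho B X).1.a11 ≠ 0 := by
    rw [e1]; exact mul_ne_zero (pow_ne_zero 2 h1) hX
  refine ⟨h11, mul_left_cancel₀ h11 ?_⟩
  rw [a11_mul_d' N _ h11, e1]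
  have c0 := fun x y => N.symm₀.eq x y
  have c1 := fun x y => N.symm₁.eq x y
  have cV := fun x y => N.symmV.eq x y
  -- The three entries of the reduced `2 × 2` block transform, up to a common scaling, by the lower
  -- triangular `2 × 2` action of `B`, so its determinant is only rescaled.
  have f0 : (N.rho B X).1.a11 * (N.rho B X).1.a22 - N.g₀ (N.rho B X).1.a12 (N.rho B X).1.a12 =
      (B.a11 * B.a22) ^ 2 * (X.1.a11 * X.1.a22 - N.g₀ X.1.a12 X.1.a12) := by
    rw [e1, e2, e4]
    simp only [map_add, LinearMap.add_apply, map_smul, LinearMap.smul_apply, smul_eq_mul,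
      c0 X.1.a12 B.a21]
    ring
  have fV : (N.rho B X).1.a11 • (N.rho B X).1.a23 - N.flatMul (N.rho B X).1.a12 (N.rho B X).1.a13 =
      (B.a11 ^ 2 * B.a22) • (B.a33 • (X.1.a11 • X.1.a23 - N.flatMul X.1.a12 X.1.a13) +
        (X.1.a11 * X.1.a22 - N.g₀ X.1.a12 X.1.a12) • B.a32) := by
    have p := N.flatMul_mu_self X.1.a12 B.a32
    rw [e1, e2, e3, e5]
    simp only [flatMul_add_left, flatMul_add_right, flatMul_smul_left, flatMul_smul_right, p]
    module
  have f1 : (N.rho B X).1.a11 * (N.rho B X).1.a33 - N.g₁ (N.rho B X).1.a13 (N.rho B X).1.a13 =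
      B.a11 ^ 2 * (B.a33 ^ 2 * (X.1.a11 * X.1.a33 - N.g₁ X.1.a13 X.1.a13) +
        (X.1.a11 * X.1.a22 - N.g₀ X.1.a12 X.1.a12) * N.gV B.a32 B.a32 +
        2 * B.a33 * N.gV (X.1.a11 • X.1.a23 - N.flatMul X.1.a12 X.1.a13) B.a32) := by
    have i := N.isometric X.1.a12 B.a32
    rw [e1, e3, e6]
    simp only [map_add, LinearMap.add_apply, map_smul, LinearMap.smul_apply, smul_eq_mul,
      map_sub, LinearMap.sub_apply, gV_flatMul, c1 X.1.a13 B.a31, cV X.1.a23 B.a32,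
      c1 (N.mu X.1.a12 B.a32) B.a31, c1 (N.mu X.1.a12 B.a32) X.1.a13, i]
    ring
  rw [← e1, f0, fV, f1, e1, detG]
  have k := N.a11_mul_d' X hX
  generalize X.1.a11 • X.1.a23 - N.flatMul X.1.a12 X.1.a13 = w at *
  simp only [map_add, LinearMap.add_apply, map_smul, LinearMap.smul_apply, smul_eq_mul,
    cV B.a32 w]
  linear_combination (-(B.a11 * (B.a11 * B.a22 * B.a33) ) ^ 2) * k

theorem d_hermOne : N.d (hermOne S₀ S₁ V) = 1 := by
  rw [d]; simp [hermOne, one]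

theorem d'_hermOne : N.d' (hermOne S₀ S₁ V) = 1 := by
  rw [d', d_hermOne]; simp [hermOne, one, flatMul_zero_left]

theorem d_eq_detG_sq {A : TMat S₀ S₁ V} (hA : A ∈ groupG S₀ S₁ V) {X : herm S₀ S₁ V}
    (h : (X : TMat S₀ S₁ V) = N.mul A A.adj) : N.d X = A.detG ^ 2 := by
  obtain rfl : X = N.rho A (hermOne S₀ S₁ V) := Subtype.ext (h.trans (N.rho_hermOne A).symm)
  rw [N.d_rho (isUpper_of_mem_groupG hA) hA.2.2.2.2.1.ne' hA.2.2.2.2.2.ne', d_hermOne,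
    _root_.mul_one]

theorem d'_eq_detG_sq {A : TMat S₀ S₁ V} (hA : A ∈ groupG S₀ S₁ V) {X : herm S₀ S₁ V}
    (h : (X : TMat S₀ S₁ V) = N.mul A.adj A) : N.d' X = A.detG ^ 2 := by
  obtain rfl : X = N.rho A.adj (hermOne S₀ S₁ V) :=
    Subtype.ext (h.trans (N.rho_hermOne A.adj).symm)
  rw [(N.d'_rho (B := A.adj) (isUpper_of_mem_groupG hA) hA.2.2.2.1.ne' _
    (by simp [hermOne, one])).2, d'_hermOne, _root_.mul_one]
  rfl

theorem d_smul (c : ℝ) (X : herm S₀ S₁ V) : N.d (c • X) = c ^ 3 * N.d X := by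
  simp [d]; ring

theorem d'_smul {c : ℝ} (hc : c ≠ 0) (X : herm S₀ S₁ V) (hX : X.1.a11 ≠ 0) :
    N.d' (c • X) = c ^ 3 * N.d' X := by
  rw [d', d_smul, d']
  simp [flatMul_smul_left, flatMul_smul_right]
  field_simp

end SpecialNilAlgebra

/-! ### Closures in the canonical topology -/

section ModuleClosure

variable {E : Type*} [AddCommGroup E] [Module ℝ E]

/-- Linear forms are continuous for the module topology, so nonnegativity is a closed condition; no
norm has to be chosen. -/
theorem nonneg_of_mem_closure {C : Set E} (ξ : Module.Dual ℝ E) (h : ∀ x ∈ C, 0 ≤ ξ x) {x : E}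
    (hx : x ∈ @closure E (moduleTopology ℝ E) C) : 0 ≤ ξ x := by
  let _ : TopologicalSpace E := moduleTopology ℝ E
  have _ : IsModuleTopology ℝ E := ⟨rfl⟩
  have hc : Continuous ξ := IsModuleTopology.continuous_of_linearMap ξ
  exact closure_minimal h (isClosed_Ici.preimage hc) hx

theorem map_mem_closure_of_linearMap {C : Set E} (f : E →ₗ[ℝ] E) (h : ∀ x ∈ C, f x ∈ C) {x : E}
    (hx : x ∈ @closure E (moduleTopology ℝ E) C) :
    f x ∈ @closure E (moduleTopology ℝ E) C := by
  let _ : TopologicalSpace E := moduleTopology ℝ E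
  have _ : IsModuleTopology ℝ E := ⟨rfl⟩
  have _ : ContinuousAdd E := IsModuleTopology.toContinuousAdd ℝ E
  have hc : Continuous f := IsModuleTopology.continuous_of_linearMap f
  exact map_mem_closure hc hx h

theorem mem_closure_of_forall_add_smul_mem {C : Set E} {x y : E}
    (h : ∀ ε : ℝ, 0 < ε → x + ε • y ∈ C) : x ∈ @closure E (moduleTopology ℝ E) C := by
  let _ : TopologicalSpace E := moduleTopology ℝ E
  have _ : IsModuleTopology ℝ E := ⟨rfl⟩
  have _ : ContinuousAdd E := IsModuleTopology.toContinuousAdd ℝ E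
  have hc : Continuous fun ε : ℝ => x + ε • y := by fun_prop
  have ht : Filter.Tendsto (fun ε : ℝ => x + ε • y) (nhdsWithin 0 (Set.Ioi 0)) (nhds x) := by
    have := hc.tendsto 0
    simp only [zero_smul, add_zero] at this
    exact this.mono_left nhdsWithin_le_nhds
  exact mem_closure_of_tendsto ht (by filter_upwards [self_mem_nhdsWithin] with ε hε using h ε hε)

end ModuleClosure

/-! ### Quadratic inequalities -/

theorem eq_zero_of_forall_nonneg_add_mul {a b : ℝ} (h : ∀ k : ℝ, 0 ≤ a + k * b) : b = 0 := by
  by_contra hb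
  have := h (-(a + 1) / b)
  rw [div_mul_cancel₀ _ hb] at this
  linarith

theorem nonneg_of_forall_quadratic_nonneg {a b c : ℝ}
    (h : ∀ k : ℝ, 0 ≤ a * k ^ 2 + b * k + c) : 0 ≤ a := by
  by_contra! ha
  -- For `a < 0` the first summand makes `a k = -(|b| + |c| + 1)`, so `a k² + b k` is at most `-(|c|
  -- + 1) k`; the extra `1` makes the argument at least `1`, and the value is negative.
  have h1 := h ((|b| + |c| + 1) / -a + 1)
  set k := (|b| + |c| + 1) / -a with hk
  have hk0 : 0 ≤ k := div_nonneg (by positivity) (by linarith)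
  have hak : a * k = -(|b| + |c| + 1) := by
    rw [hk]; have := ha.ne; field_simp
  have := le_abs_self b
  have := le_abs_self c
  nlinarith [abs_nonneg b, abs_nonneg c, mul_nonneg (abs_nonneg c) hk0,
    mul_le_mul_of_nonneg_right (le_abs_self b) hk0]

theorem eq_zero_of_forall_quadratic_nonneg {a b : ℝ} (h : ∀ k : ℝ, 0 ≤ a * k ^ 2 + b * k) :
    b = 0 := by
  by_contra hb
  have hA : 0 < |a| + 1 := by positivity
  -- A small step against the sign of `b`: the denominator exceeds `a`, so the linear term outweighs
  -- the quadratic one.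
  have h1 := h (-b / (|a| + 1))
  have e : (a * (-b / (|a| + 1)) ^ 2 + b * (-b / (|a| + 1))) * (|a| + 1) ^ 2 =
      b ^ 2 * (a - (|a| + 1)) := by
    field_simp; ring
  have hb2 : 0 < b ^ 2 := by positivity
  have := mul_nonneg h1 (sq_nonneg (|a| + 1))
  nlinarith [le_abs_self a]

section PosDef

variable {E : Type*} [AddCommGroup E] [Module ℝ E] {g : LinearMap.BilinForm ℝ E}

theorem posDef_of_nonneg_of_nondegenerate (hs : g.IsSymm) (hn : g.Nondegenerate)
    (h : ∀ x, 0 ≤ g x x) : g.toQuadraticMap.PosDef := by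
  intro x hx
  rw [LinearMap.BilinMap.toQuadraticMap_apply]
  refine lt_of_le_of_ne (h x) fun h0 => hx ?_
  refine hn.1 x fun y => ?_
  -- Along an isotropic direction the form is affine; being bounded below, it has slope zero, so `x`
  -- lies in the radical.
  have := eq_zero_of_forall_nonneg_add_mul (a := g y y) (b := 2 * g x y) fun k => by
    have h1 := h (y + k • x)
    have h2 := hs.eq x y
    simp only [map_add, LinearMap.add_apply, map_smul, LinearMap.smul_apply, smul_eq_mul,
      RingHom.id_apply, ← h0] at h1 h2
    rw [← h2] at h1
    linarith
  linarith

/-- The minimum of a quadratic polynomial with leading part a multiple of `g`. -/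
theorem le_mul_of_forall_nonneg {a b : ℝ} (hb : 0 ≤ b) {u : E}
    (h : ∀ s, 0 ≤ a + b * g s s + 2 * g s u) : g u u ≤ a * b := by
  rcases hb.eq_or_lt with rfl | hb
  · have := eq_zero_of_forall_nonneg_add_mul (a := a) (b := 2 * g u u) fun k => by
      have := h (k • u)
      simp only [map_smul, LinearMap.smul_apply, smul_eq_mul] at this
      linarith
    linarith
  · have := h (-(b⁻¹) • u)
    simp only [map_smul, LinearMap.smul_apply, smul_eq_mul] at this
    have e : b * (a + b * (-b⁻¹ * (-b⁻¹ * g u u)) + 2 * (-b⁻¹ * g u u)) = a * b - g u u := by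
      field_simp; ring
    nlinarith [mul_nonneg hb.le this]

theorem lt_mul_of_forall_pos {a b : ℝ} (hb : 0 < b) {u : E}
    (h : ∀ s, 0 < a + b * g s s + 2 * g s u) : g u u < a * b := by
  have := h (-(b⁻¹) • u)
  simp only [map_smul, LinearMap.smul_apply, smul_eq_mul] at this
  have e : b * (a + b * (-b⁻¹ * (-b⁻¹ * g u u)) + 2 * (-b⁻¹ * g u u)) = a * b - g u u := by
    field_simp; ring
  nlinarith [mul_pos hb this]

end PosDef

namespace SpecialNilAlgebra

open TMat

variable {S₀ S₁ V : Type*} [AddCommGroup S₀] [Module ℝ S₀] [FiniteDimensional ℝ S₀]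
    [AddCommGroup S₁] [Module ℝ S₁] [FiniteDimensional ℝ S₁]
    [AddCommGroup V] [Module ℝ V] [FiniteDimensional ℝ V]
    (N : SpecialNilAlgebra S₀ S₁ V)

/-! ### The cone and its closure -/

instance : FiniteDimensional ℝ (TMat S₀ S₁ V) :=
  Module.Finite.equiv
    ((equivProd S₀ S₁ V).linearEquiv ℝ).symm

/-- A Hermitian matrix given by its entries on and above the diagonal. -/
def mkHerm (x₁ : ℝ) (s : S₀) (p : S₁) (x₂ : ℝ) (v : V) (x₃ : ℝ) : herm S₀ S₁ V :=
  ⟨⟨x₁, s, p, s, x₂, v, p, v, x₃⟩, rfl⟩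

theorem mem_cone_iff {X : herm S₀ S₁ V} :
    X ∈ N.cone ↔ ∃ A ∈ groupG S₀ S₁ V, X = N.rho A (hermOne S₀ S₁ V) := by
  refine exists_congr fun A => and_congr_right fun _ => ?_
  rw [← rho_hermOne, SetLike.coe_eq_coe]

theorem mul_mem_groupG {A B : TMat S₀ S₁ V} (hA : A ∈ groupG S₀ S₁ V)
    (hB : B ∈ groupG S₀ S₁ V) : N.mul A B ∈ groupG S₀ S₁ V := by
  obtain ⟨a1, a2, a3, a4, a5, a6⟩ := hA
  obtain ⟨b1, b2, b3, b4, b5, b6⟩ := hB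
  refine ⟨?_, ?_, ?_, ?_, ?_, ?_⟩ <;>
    simp [a1, a2, a3, b1, b2, b3, mulVFlat_zero_left, flatMul_zero_left, flatMul_zero_right,
      mul_pos, a4, a5, a6, b4, b5, b6]

theorem unip_mem_groupG (s : S₀) (p : S₁) (q : V) : unip s p q ∈ groupG S₀ S₁ V :=
  ⟨rfl, rfl, rfl, one_pos, one_pos, one_pos⟩

theorem rho_mem_cone {A : TMat S₀ S₁ V} (hA : A ∈ groupG S₀ S₁ V) {X : herm S₀ S₁ V}
    (hX : X ∈ N.cone) : N.rho A X ∈ N.cone := by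
  obtain ⟨B, hB, rfl⟩ := N.mem_cone_iff.1 hX
  exact N.mem_cone_iff.2 ⟨_, N.mul_mem_groupG hA hB,
    (N.rho_mul_upper A B (isUpper_of_mem_groupG hA) (isUpper_of_mem_groupG hB) _).symm⟩

/-- The closure of the cone in the canonical topology. -/
def closedCone : Set (herm S₀ S₁ V) := @closure _ (moduleTopology ℝ (herm S₀ S₁ V)) N.cone

theorem rho_mem_closedCone {A : TMat S₀ S₁ V} (hA : A ∈ groupG S₀ S₁ V) {X : herm S₀ S₁ V}
    (hX : X ∈ N.closedCone) : N.rho A X ∈ N.closedCone :=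
  map_mem_closure_of_linearMap _ (fun _ => N.rho_mem_cone hA) hX

theorem mkHerm_diag_mem_cone {a b c : ℝ} (ha : 0 < a) (hb : 0 < b) (hc : 0 < c) :
    mkHerm a 0 0 b 0 c ∈ N.cone := by
  refine ⟨diag S₀ S₁ V (√a) (√b) (√c), ⟨rfl, rfl, rfl, Real.sqrt_pos.2 ha, Real.sqrt_pos.2 hb,
    Real.sqrt_pos.2 hc⟩, ?_⟩
  ext <;> simp [mkHerm, diag, mulVFlat_zero_left, flatMul_zero_left, flatMul_zero_right, ha.le,
    hb.le, hc.le]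

theorem mkHerm_diag_mem_closedCone {a b c : ℝ} (ha : 0 ≤ a) (hb : 0 ≤ b) (hc : 0 ≤ c) :
    mkHerm a 0 0 b 0 c ∈ N.closedCone := by
  refine mem_closure_of_forall_add_smul_mem (y := hermOne S₀ S₁ V) fun ε hε => ?_
  have : mkHerm a 0 0 b 0 c + ε • hermOne S₀ S₁ V =
      mkHerm (a + ε) (0 : S₀) (0 : S₁) (b + ε) (0 : V) (c + ε) := by
    apply herm_ext <;> simp [mkHerm, hermOne, one]
  rw [this]
  exact N.mkHerm_diag_mem_cone (by linarith) (by linarith) (by linarith)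

/-- The transforms of the second diagonal unit. -/
theorem rho_unip_diag₂ (s : S₀) :
    N.rho (unip s 0 0) (mkHerm 0 0 0 1 0 0) = mkHerm (N.g₀ s s) s 0 1 0 0 := by
  obtain ⟨e1, e2, e3, e4, e5, e6⟩ := N.rho_upper _ (isUpper_unip s 0 0) (mkHerm 0 0 0 1 0 0)
  apply herm_ext <;> simp [e1, e2, e3, e4, e5, e6] <;> simp [mkHerm, unip, mulVFlat_zero_left,
    mulVFlat_zero_right]

/-- The transforms of the third diagonal unit. -/
theorem rho_unip_diag₃ (p : S₁) (q : V) :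
    N.rho (unip 0 p q) (mkHerm 0 0 0 0 0 1) =
      mkHerm (N.g₁ p p) (N.mulVFlat p q) p (N.gV q q) q 1 := by
  obtain ⟨e1, e2, e3, e4, e5, e6⟩ := N.rho_upper _ (isUpper_unip 0 p q) (mkHerm 0 0 0 0 0 1)
  apply herm_ext <;> simp [e1, e2, e3, e4, e5, e6] <;> simp [mkHerm, unip, mulVFlat_zero_left,
    mulVFlat_zero_right]

theorem mkHerm₂_mem_closedCone (s : S₀) : mkHerm (N.g₀ s s) s 0 1 0 0 ∈ N.closedCone := by
  rw [← rho_unip_diag₂]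
  exact N.rho_mem_closedCone (unip_mem_groupG _ _ _)
    (N.mkHerm_diag_mem_closedCone le_rfl zero_le_one le_rfl)

theorem mkHerm₃_mem_closedCone (p : S₁) (q : V) :
    mkHerm (N.g₁ p p) (N.mulVFlat p q) p (N.gV q q) q 1 ∈ N.closedCone := by
  rw [← rho_unip_diag₃]
  exact N.rho_mem_closedCone (unip_mem_groupG _ _ _)
    (N.mkHerm_diag_mem_closedCone le_rfl le_rfl zero_le_one)

/-- The inverse of `unip`. -/
theorem rho_unip_neg (s : S₀) (p : S₁) (q : V) (X : herm S₀ S₁ V) :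
    N.rho (unip s p q) (N.rho (unip (-s) (N.mu s q - p) (-q)) X) = X ∧
    N.rho (unip (-s) (N.mu s q - p) (-q)) (N.rho (unip s p q) X) = X := by
  constructor <;> rw [← N.rho_mul_upper _ _ (isUpper_unip _ _ _) (isUpper_unip _ _ _)] <;>
    convert N.rho_one X <;> ext <;> simp [unip, one, mulVFlat_zero_left, mulVFlat_zero_right,
      flatMul_zero_left, flatMul_zero_right] <;> abel

/-! ### Inequalities on the closed cone in the Euclidean case -/

/-- All three inner products are positive definite. -/
structure IsEuclidean (N : SpecialNilAlgebra S₀ S₁ V) : Prop where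
  pos₀ : ∀ x, x ≠ 0 → 0 < N.g₀ x x
  pos₁ : ∀ x, x ≠ 0 → 0 < N.g₁ x x
  posV : ∀ x, x ≠ 0 → 0 < N.gV x x

section Entries

variable (S₀ S₁ V)

/-- The entry in position `11` of a Hermitian matrix as a linear map. -/
@[simps] def e11 : herm S₀ S₁ V →ₗ[ℝ] ℝ where
  toFun X := X.1.a11
  map_add' _ _ := rfl
  map_smul' _ _ := rfl

/-- The entry in position `12` as a linear map. -/
@[simps] def e12 : herm S₀ S₁ V →ₗ[ℝ] S₀ where
  toFun X := X.1.a12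
  map_add' _ _ := rfl
  map_smul' _ _ := rfl

/-- The entry in position `13` as a linear map. -/
@[simps] def e13 : herm S₀ S₁ V →ₗ[ℝ] S₁ where
  toFun X := X.1.a13
  map_add' _ _ := rfl
  map_smul' _ _ := rfl

/-- The entry in position `22` as a linear map. -/
@[simps] def e22 : herm S₀ S₁ V →ₗ[ℝ] ℝ where
  toFun X := X.1.a22
  map_add' _ _ := rfl
  map_smul' _ _ := rfl

/-- The entry in position `23` as a linear map. -/
@[simps] def e23 : herm S₀ S₁ V →ₗ[ℝ] V where
  toFun X := X.1.a23
  map_add' _ _ := rfl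
  map_smul' _ _ := rfl

/-- The entry in position `33` as a linear map. -/
@[simps] def e33 : herm S₀ S₁ V →ₗ[ℝ] ℝ where
  toFun X := X.1.a33
  map_add' _ _ := rfl
  map_smul' _ _ := rfl

end Entries

/-- The first diagonal entry of `ρ_U(X)` for unipotent upper triangular `U`. -/
theorem rho_unip_a11 (s : S₀) (p : S₁) (q : V) (X : herm S₀ S₁ V) :
    (N.rho (unip s p q) X).1.a11 = X.1.a11 + X.1.a22 * N.g₀ s s + X.1.a33 * N.g₁ p p +
      2 * N.g₀ s X.1.a12 + 2 * N.g₁ p X.1.a13 + 2 * N.g₁ p (N.mu s X.1.a23) := by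
  rw [(N.rho_upper _ (isUpper_unip s p q) X).1]
  simp [unip]

theorem rho_unip_a22 (s : S₀) (p : S₁) (q : V) (X : herm S₀ S₁ V) :
    (N.rho (unip s p q) X).1.a22 = X.1.a22 + X.1.a33 * N.gV q q + 2 * N.gV q X.1.a23 := by
  rw [(N.rho_upper _ (isUpper_unip s p q) X).2.2.2.1]
  simp [unip]; ring

theorem smul_mem_cone {t : ℝ} (ht : 0 < t) {X : herm S₀ S₁ V} (hX : X ∈ N.cone) :
    t • X ∈ N.cone := by
  have hd : diag S₀ S₁ V (√t) (√t) (√t) ∈ groupG S₀ S₁ V :=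
    ⟨rfl, rfl, rfl, Real.sqrt_pos.2 ht, Real.sqrt_pos.2 ht, Real.sqrt_pos.2 ht⟩
  have h := N.rho_mem_cone hd hX
  obtain ⟨e1, e2, e3, e4, e5, e6⟩ := N.rho_upper _ (isUpper_of_mem_groupG hd) X
  have hs := Real.mul_self_sqrt ht.le
  convert h using 1
  apply herm_ext <;> simp [e1, e2, e3, e4, e5, e6] <;> simp [diag, mulVFlat_zero_left,
    mulVFlat_zero_right, ht.le]

theorem smul_mem_closedCone {t : ℝ} (ht : 0 < t) {X : herm S₀ S₁ V} (hX : X ∈ N.closedCone) :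
    t • X ∈ N.closedCone :=
  map_mem_closure_of_linearMap (t • LinearMap.id) (fun _ => N.smul_mem_cone ht) hX

namespace IsEuclidean

variable {N}

theorem nonneg₀ (h : N.IsEuclidean) (x : S₀) : 0 ≤ N.g₀ x x := by
  by_cases hx : x = 0
  · simp [hx]
  · exact (h.pos₀ x hx).le

theorem nonneg₁ (h : N.IsEuclidean) (x : S₁) : 0 ≤ N.g₁ x x := by
  by_cases hx : x = 0
  · simp [hx]
  · exact (h.pos₁ x hx).le

theorem nonnegV (h : N.IsEuclidean) (x : V) : 0 ≤ N.gV x x := by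
  by_cases hx : x = 0
  · simp [hx]
  · exact (h.posV x hx).le

theorem eq_zero₀ (h : N.IsEuclidean) {x : S₀} (hx : N.g₀ x x ≤ 0) : x = 0 := by
  by_contra h0
  exact absurd (h.pos₀ x h0) hx.not_gt

theorem eq_zero₁ (h : N.IsEuclidean) {x : S₁} (hx : N.g₁ x x ≤ 0) : x = 0 := by
  by_contra h0
  exact absurd (h.pos₁ x h0) hx.not_gt

theorem eq_zeroV (h : N.IsEuclidean) {x : V} (hx : N.gV x x ≤ 0) : x = 0 := by
  by_contra h0
  exact absurd (h.posV x h0) hx.not_gt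

theorem diag_pos_of_mem_cone (h : N.IsEuclidean) {X : herm S₀ S₁ V} (hX : X ∈ N.cone) :
    0 < X.1.a11 ∧ 0 < X.1.a22 ∧ 0 < X.1.a33 := by
  obtain ⟨A, hA, e⟩ := hX
  obtain ⟨a1, a2, a3, a4, a5, a6⟩ := hA
  have h0 := h.nonneg₀ A.a12
  have h1 := h.nonneg₁ A.a13
  have hV := h.nonnegV A.a23
  rw [e]
  refine ⟨?_, ?_, ?_⟩ <;> simp [a1, a2, a3] <;> positivity

theorem diag_nonneg (h : N.IsEuclidean) {X : herm S₀ S₁ V} (hX : X ∈ N.closedCone) :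
    0 ≤ X.1.a11 ∧ 0 ≤ X.1.a22 ∧ 0 ≤ X.1.a33 :=
  ⟨nonneg_of_mem_closure (e11 S₀ S₁ V) (fun _ hY => (h.diag_pos_of_mem_cone hY).1.le) hX,
    nonneg_of_mem_closure (e22 S₀ S₁ V) (fun _ hY => (h.diag_pos_of_mem_cone hY).2.1.le) hX,
    nonneg_of_mem_closure (e33 S₀ S₁ V) (fun _ hY => (h.diag_pos_of_mem_cone hY).2.2.le) hX⟩

theorem rho_unip_a11_nonneg (h : N.IsEuclidean) {X : herm S₀ S₁ V} (hX : X ∈ N.closedCone)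
    (s : S₀) (p : S₁) (q : V) : 0 ≤ (N.rho (unip s p q) X).1.a11 :=
  (h.diag_nonneg (N.rho_mem_closedCone (unip_mem_groupG s p q) hX)).1

/-- Closed-cone elements keep a nonnegative corner under every unipotent transform. That corner is a
quadratic polynomial in `s`, and minimizing it yields the `2 × 2` minor; the two bounds below arise
likewise. -/
theorem norm_a12_le (h : N.IsEuclidean) {X : herm S₀ S₁ V} (hX : X ∈ N.closedCone) :
    N.g₀ X.1.a12 X.1.a12 ≤ X.1.a11 * X.1.a22 :=
  le_mul_of_forall_nonneg (h.diag_nonneg hX).2.1 fun s => by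
    have := h.rho_unip_a11_nonneg hX s 0 0
    rw [rho_unip_a11] at this
    simpa using this

theorem norm_a13_le (h : N.IsEuclidean) {X : herm S₀ S₁ V} (hX : X ∈ N.closedCone) :
    N.g₁ X.1.a13 X.1.a13 ≤ X.1.a11 * X.1.a33 :=
  le_mul_of_forall_nonneg (h.diag_nonneg hX).2.2 fun s => by
    have := h.rho_unip_a11_nonneg hX 0 s 0
    rw [rho_unip_a11] at this
    simpa using this

theorem norm_a23_le (h : N.IsEuclidean) {X : herm S₀ S₁ V} (hX : X ∈ N.closedCone) :
    N.gV X.1.a23 X.1.a23 ≤ X.1.a22 * X.1.a33 :=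
  le_mul_of_forall_nonneg (h.diag_nonneg hX).2.2 fun s => by
    have := (h.diag_nonneg (N.rho_mem_closedCone (unip_mem_groupG 0 0 s) hX)).2.1
    rw [rho_unip_a22] at this
    simpa using this

/-- The trace. -/
def _root_.SpecialNilAlgebra.trace (S₀ S₁ V : Type*) [AddCommGroup S₀] [Module ℝ S₀]
    [AddCommGroup S₁] [Module ℝ S₁] [AddCommGroup V] [Module ℝ V] :
    Module.Dual ℝ (herm S₀ S₁ V) := e11 S₀ S₁ V + e22 S₀ S₁ V + e33 S₀ S₁ V

theorem trace_pos (h : N.IsEuclidean) {X : herm S₀ S₁ V} (hX : X ∈ N.closedCone) (h0 : X ≠ 0) :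
    0 < trace S₀ S₁ V X := by
  obtain ⟨h1, h2, h3⟩ := h.diag_nonneg hX
  have ht : trace S₀ S₁ V X = X.1.a11 + X.1.a22 + X.1.a33 := rfl
  by_contra! hle
  rw [ht] at hle
  have z1 : X.1.a11 = 0 := by linarith
  have z2 : X.1.a22 = 0 := by linarith
  have z3 : X.1.a33 = 0 := by linarith
  have k1 := h.norm_a12_le hX
  have k2 := h.norm_a13_le hX
  have k3 := h.norm_a23_le hX
  rw [z1, zero_mul] at k1 k2
  rw [z2, zero_mul] at k3
  exact h0 (herm_ext z1 (h.eq_zero₀ k1) (h.eq_zero₁ k2) z2 (h.eq_zeroV k3) z3)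

/-- Every element of the closed cone is a sum of transforms of diagonal units. -/
theorem exists_eq_add_add (h : N.IsEuclidean) {X : herm S₀ S₁ V} (hX : X ∈ N.closedCone) :
    ∃ c₁ c₂ c₃ : herm S₀ S₁ V, X = c₁ + c₂ + c₃ ∧
      (∃ a : ℝ, 0 ≤ a ∧ c₁ = mkHerm a 0 0 0 0 0) ∧
      (c₂ = 0 ∨ ∃ t : ℝ, 0 < t ∧ ∃ s, c₂ = t • N.rho (unip s 0 0) (mkHerm 0 0 0 1 0 0)) ∧
      (c₃ = 0 ∨ ∃ t : ℝ, 0 < t ∧ ∃ p q, c₃ = t • N.rho (unip 0 p q) (mkHerm 0 0 0 0 0 1)) := by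
  have two : ∀ (x₁ x₂ : ℝ) (s : S₀), 0 ≤ x₁ → 0 ≤ x₂ → N.g₀ s s ≤ x₁ * x₂ →
      ∃ c₁ c₂ : herm S₀ S₁ V, mkHerm x₁ s 0 x₂ 0 0 = c₁ + c₂ ∧
      (∃ a : ℝ, 0 ≤ a ∧ c₁ = mkHerm a 0 0 0 0 0) ∧
      (c₂ = 0 ∨ ∃ t : ℝ, 0 < t ∧ ∃ s, c₂ = t • N.rho (unip s 0 0) (mkHerm 0 0 0 1 0 0)) := by
    intro x₁ x₂ s h1 h2 hs
    rcases h2.eq_or_lt with rfl | h2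
    · obtain rfl := h.eq_zero₀ (hs.trans_eq (mul_zero _))
      exact ⟨_, 0, (add_zero _).symm, ⟨x₁, h1, rfl⟩, Or.inl rfl⟩
    · refine ⟨mkHerm (x₁ - N.g₀ s s / x₂) 0 0 0 0 0, _, ?_, ⟨_, ?_, rfl⟩,
        Or.inr ⟨x₂, h2, x₂⁻¹ • s, rfl⟩⟩
      · rw [rho_unip_diag₂]
        apply herm_ext <;> simp [mkHerm, h2.ne']
        field_simp; ring
      · rw [sub_nonneg, div_le_iff₀ h2]; exact hs
  obtain ⟨h1, h2, h3⟩ := h.diag_nonneg hX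
  have k1 := h.norm_a12_le hX
  have k2 := h.norm_a13_le hX
  have k3 := h.norm_a23_le hX
  rcases h3.eq_or_lt with h3 | h3
  · rw [← h3, mul_zero] at k2 k3
    obtain ⟨c₁, c₂, e, hc₁, hc₂⟩ := two _ _ _ h1 h2 k1
    refine ⟨c₁, c₂, 0, ?_, hc₁, hc₂, Or.inl rfl⟩
    rw [add_zero, ← e]
    exact herm_ext rfl rfl (h.eq_zero₁ k2) rfl (h.eq_zeroV k3) h3.symm
  · set a := X.1.a33 with ha
    have b1 : 0 ≤ X.1.a11 - N.g₁ X.1.a13 X.1.a13 / a := by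
      rw [sub_nonneg, div_le_iff₀ h3]; exact k2
    have b2 : 0 ≤ X.1.a22 - N.gV X.1.a23 X.1.a23 / a := by
      rw [sub_nonneg, div_le_iff₀ h3]; exact k3
    obtain ⟨c₁, c₂, e, hc₁, hc₂⟩ := two _ _ (X.1.a12 - a⁻¹ • N.mulVFlat X.1.a13 X.1.a23) b1 b2 <|
      le_mul_of_forall_nonneg b2 fun s => by
        -- For fixed `s` this choice minimizes the corner over the `13` entry. What remains is a
        -- quadratic in `s` with the coefficients of the reduced block.
        have := h.rho_unip_a11_nonneg hX s (-a⁻¹ • (X.1.a13 + N.mu s X.1.a23)) 0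
        rw [rho_unip_a11] at this
        have i := N.isometric s X.1.a23
        have c1 := N.symm₁.eq (N.mu s X.1.a23) X.1.a13
        have c1' := N.g₁_mu s X.1.a23 X.1.a13
        simp only [map_add, LinearMap.add_apply, map_smul, LinearMap.smul_apply, smul_eq_mul, i,
          map_sub, ← c1, c1', ← ha] at this ⊢
        refine this.trans_eq ?_
        field_simp
        ring
    refine ⟨c₁, c₂, a • N.rho (unip 0 (a⁻¹ • X.1.a13) (a⁻¹ • X.1.a23)) (mkHerm 0 0 0 0 0 1), ?_,
      hc₁, hc₂, Or.inr ⟨a, h3, _, _, rfl⟩⟩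
    rw [← e, rho_unip_diag₃]
    apply herm_ext <;> simp [mkHerm, h3.ne', mulVFlat_smul_left, mulVFlat_smul_right, smul_smul]
    · field_simp; ring
    · field_simp; ring
    · rfl

end IsEuclidean

end SpecialNilAlgebra

namespace SpecialNilAlgebra

open TMat

variable {S₀ S₁ V : Type*} [AddCommGroup S₀] [Module ℝ S₀] [FiniteDimensional ℝ S₀]
    [AddCommGroup S₁] [Module ℝ S₁] [FiniteDimensional ℝ S₁]
    [AddCommGroup V] [Module ℝ V] [FiniteDimensional ℝ V]
    {N : SpecialNilAlgebra S₀ S₁ V}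

theorem mkHerm_eq (x₁ : ℝ) (s : S₀) (p : S₁) (x₂ : ℝ) (v : V) (x₃ : ℝ) :
    mkHerm x₁ s p x₂ v x₃ = x₁ • mkHerm 1 0 0 0 0 0 + mkHerm 0 s 0 0 0 0 +
      mkHerm 0 0 p 0 0 0 + x₂ • mkHerm 0 0 0 1 0 0 + mkHerm 0 0 0 0 v 0 +
      x₃ • mkHerm 0 0 0 0 0 1 := by
  apply herm_ext <;> simp [mkHerm]

theorem eq_mkHerm (X : herm S₀ S₁ V) :
    X = mkHerm X.1.a11 X.1.a12 X.1.a13 X.1.a22 X.1.a23 X.1.a33 :=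
  herm_ext rfl rfl rfl rfl rfl rfl

theorem mkHerm_zero : mkHerm 0 (0 : S₀) (0 : S₁) 0 (0 : V) 0 = 0 := rfl

theorem mkHerm_smul (k : ℝ) :
    (∀ s : S₀, mkHerm 0 (k • s) (0 : S₁) 0 (0 : V) 0 = k • mkHerm 0 s 0 0 0 0) ∧
    (∀ p : S₁, mkHerm 0 (0 : S₀) (k • p) 0 (0 : V) 0 = k • mkHerm 0 0 p 0 0 0) ∧
    (∀ v : V, mkHerm 0 (0 : S₀) (0 : S₁) 0 (k • v) 0 = k • mkHerm 0 0 0 0 v 0) := by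
  refine ⟨fun s => ?_, fun s => ?_, fun s => ?_⟩ <;> apply herm_ext <;> simp [mkHerm]

/-! ### Self-adjointness implies that the inner products are Euclidean -/

theorem isEuclidean_of_adjointCone_nonempty (h : (adjointCone N.cone).Nonempty) :
    N.IsEuclidean := by
  obtain ⟨ξ, hξ⟩ := h
  have hpos : ∀ X ∈ N.closedCone, X ≠ 0 → 0 < ξ X := hξ
  have hnn : ∀ X ∈ N.closedCone, 0 ≤ ξ X := fun X hX => by
    by_cases h0 : X = 0
    · simp [h0]
    · exact (hpos X hX h0).le
  have p1 : 0 < ξ (mkHerm 1 0 0 0 0 0) := by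
    refine hpos _ (N.mkHerm_diag_mem_closedCone zero_le_one le_rfl le_rfl) fun h0 => ?_
    exact one_ne_zero ((congrArg (e11 S₀ S₁ V) h0).trans (map_zero _))
  have p2 : 0 < ξ (mkHerm 0 0 0 1 0 0) := by
    refine hpos _ (N.mkHerm_diag_mem_closedCone le_rfl zero_le_one le_rfl) fun h0 => ?_
    exact one_ne_zero ((congrArg (e22 S₀ S₁ V) h0).trans (map_zero _))
  -- Positivity on the orbit of the second unit gives a quadratic in `k` with leading coefficient
  -- `|s|² ξ(E₁₁)`. The third unit serves for `g₁`, and for `gV` with `ξ(E₂₂)` instead.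
  have n0 : ∀ s, 0 ≤ N.g₀ s s := fun s => by
    have := nonneg_of_forall_quadratic_nonneg (a := N.g₀ s s * ξ (mkHerm 1 0 0 0 0 0))
      (b := ξ (mkHerm 0 s 0 0 0 0)) (c := ξ (mkHerm 0 0 0 1 0 0)) fun k => by
        have := hnn _ (N.mkHerm₂_mem_closedCone (k • s))
        rw [mkHerm_eq, (mkHerm_smul k).1, mkHerm_zero] at this
        simp only [map_add, map_smul, LinearMap.smul_apply, smul_eq_mul, map_zero] at this
        linarith
    exact nonneg_of_mul_nonneg_left this p1
  have n1 : ∀ s, 0 ≤ N.g₁ s s := fun s => by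
    have := nonneg_of_forall_quadratic_nonneg (a := N.g₁ s s * ξ (mkHerm 1 0 0 0 0 0))
      (b := ξ (mkHerm 0 0 s 0 0 0)) (c := ξ (mkHerm 0 0 0 0 0 1)) fun k => by
        have := hnn _ (N.mkHerm₃_mem_closedCone (k • s) 0)
        rw [mkHerm_eq, (mkHerm_smul k).2.1, mulVFlat_zero_right, mkHerm_zero] at this
        simp only [map_add, map_smul, LinearMap.smul_apply, smul_eq_mul, map_zero] at this
        linarith
    exact nonneg_of_mul_nonneg_left this p1
  have nV : ∀ s, 0 ≤ N.gV s s := fun s => by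
    have := nonneg_of_forall_quadratic_nonneg (a := N.gV s s * ξ (mkHerm 0 0 0 1 0 0))
      (b := ξ (mkHerm 0 0 0 0 s 0)) (c := ξ (mkHerm 0 0 0 0 0 1)) fun k => by
        have := hnn _ (N.mkHerm₃_mem_closedCone 0 (k • s))
        rw [mkHerm_eq, (mkHerm_smul k).2.2, mulVFlat_zero_left, mkHerm_zero] at this
        simp only [map_add, map_smul, LinearMap.smul_apply, smul_eq_mul, map_zero] at this
        linarith
    exact nonneg_of_mul_nonneg_left this p2
  refine ⟨fun x hx => ?_, fun x hx => ?_, fun x hx => ?_⟩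
  · simpa using posDef_of_nonneg_of_nondegenerate N.symm₀ N.nondeg₀ n0 x hx
  · simpa using posDef_of_nonneg_of_nondegenerate N.symm₁ N.nondeg₁ n1 x hx
  · simpa using posDef_of_nonneg_of_nondegenerate N.symmV N.nondegV nV x hx

/-! ### Faces of the cone -/

/-- The linear form `X ↦ x₁` spans an extreme ray of the dual cone. -/
theorem eq_smul_a11_of_le (ξ : Module.Dual ℝ (herm S₀ S₁ V))
    (h0 : ∀ X ∈ N.closedCone, 0 ≤ ξ X) (h1 : ∀ X ∈ N.closedCone, ξ X ≤ X.1.a11)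
    (X : herm S₀ S₁ V) : ξ X = ξ (mkHerm 1 0 0 0 0 0) * X.1.a11 := by
  -- The form is squeezed between `0` and `x₁`, so it vanishes on the second and third units. Along
  -- their orbits there is then no constant term, and nonnegativity kills the linear terms as well.
  have z2 : ξ (mkHerm 0 0 0 1 0 0) = 0 := by
    have := N.mkHerm_diag_mem_closedCone le_rfl zero_le_one le_rfl
    exact le_antisymm (h1 _ this) (h0 _ this)
  have z3 : ξ (mkHerm 0 0 0 0 0 1) = 0 := by
    have := N.mkHerm_diag_mem_closedCone le_rfl le_rfl zero_le_one
    exact le_antisymm (h1 _ this) (h0 _ this)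
  have w0 : ∀ s, ξ (mkHerm 0 s 0 0 0 0) = 0 := fun s =>
    eq_zero_of_forall_quadratic_nonneg (a := N.g₀ s s * ξ (mkHerm 1 0 0 0 0 0)) fun k => by
      have := h0 _ (N.mkHerm₂_mem_closedCone (k • s))
      rw [mkHerm_eq, (mkHerm_smul k).1, mkHerm_zero] at this
      simp only [map_add, map_smul, LinearMap.smul_apply, smul_eq_mul, z2, z3, map_zero] at this
      linarith
  have w1 : ∀ s, ξ (mkHerm 0 0 s 0 0 0) = 0 := fun s =>
    eq_zero_of_forall_quadratic_nonneg (a := N.g₁ s s * ξ (mkHerm 1 0 0 0 0 0)) fun k => by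
      have := h0 _ (N.mkHerm₃_mem_closedCone (k • s) 0)
      rw [mkHerm_eq, (mkHerm_smul k).2.1, mulVFlat_zero_right, mkHerm_zero] at this
      simp only [map_add, map_smul, LinearMap.smul_apply, smul_eq_mul, z2, z3, map_zero] at this
      linarith
  have wV : ∀ s, ξ (mkHerm 0 0 0 0 s 0) = 0 := fun s =>
    eq_zero_of_forall_quadratic_nonneg (a := 0) fun k => by
      have := h0 _ (N.mkHerm₃_mem_closedCone 0 (k • s))
      rw [mkHerm_eq, (mkHerm_smul k).2.2, mulVFlat_zero_left, mkHerm_zero] at this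
      simp only [map_add, map_smul, LinearMap.smul_apply, smul_eq_mul, z2, z3, map_zero] at this
      linarith
  conv_lhs => rw [eq_mkHerm X, mkHerm_eq]
  simp only [map_add, map_smul, smul_eq_mul, z2, z3, w0, w1, wV]
  ring

/-- Unipotent matrices act by automorphisms of the closed cone, which carry the extreme ray of `x₁`
to that of its transform. -/
theorem eq_smul_rho_a11_of_le (ξ : Module.Dual ℝ (herm S₀ S₁ V)) (s : S₀)
    (h0 : ∀ X ∈ N.closedCone, 0 ≤ ξ X)
    (h1 : ∀ X ∈ N.closedCone, ξ X ≤ (N.rho (unip s 0 0) X).1.a11) :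
    ∃ μ : ℝ, ∀ X, ξ X = μ * (N.rho (unip s 0 0) X).1.a11 := by
  have hr := N.rho_unip_neg s 0 0
  have := eq_smul_a11_of_le (N := N) (ξ ∘ₗ N.rho (unip (-s) (N.mu s 0 - 0) (-0)))
    (fun X hX => h0 _ (N.rho_mem_closedCone (unip_mem_groupG _ _ _) hX)) (fun X hX => by
      have := h1 _ (N.rho_mem_closedCone (unip_mem_groupG (-s) (N.mu s 0 - 0) (-0)) hX)
      rwa [(hr X).1] at this)
  refine ⟨ξ (N.rho (unip (-s) (N.mu s 0 - 0) (-0)) (mkHerm 1 0 0 0 0 0)), fun X => ?_⟩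
  have h := this (N.rho (unip s 0 0) X)
  rw [LinearMap.comp_apply, (hr X).2] at h
  exact h

/-! ### Forms that identify the cone with its adjoint cone, and comparison of faces -/

/-- A Euclidean inner product that identifies the cone with its adjoint cone. -/
structure IsSelfDualForm (N : SpecialNilAlgebra S₀ S₁ V)
    (B : LinearMap.BilinForm ℝ (herm S₀ S₁ V)) : Prop where
  isSymm : B.IsSymm
  posDef : B.toQuadraticMap.PosDef
  adjointCone_eq : adjointCone N.cone = (fun x => B x) '' N.cone

namespace IsSelfDualForm

variable {B : LinearMap.BilinForm ℝ (herm S₀ S₁ V)}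

theorem isEuclidean (hB : IsSelfDualForm N B) : N.IsEuclidean := by
  refine isEuclidean_of_adjointCone_nonempty ?_
  rw [hB.adjointCone_eq]
  exact ⟨_, _, N.mkHerm_diag_mem_cone one_pos one_pos one_pos, rfl⟩

theorem injective (hB : IsSelfDualForm N B) : Function.Injective B := by
  rw [← LinearMap.ker_eq_bot, LinearMap.ker_eq_bot']
  intro x hx
  by_contra h0
  have := hB.posDef x h0
  rw [LinearMap.BilinMap.toQuadraticMap_apply, hx] at this
  exact lt_irrefl _ this

/-- The linear equivalence with the dual space. -/
noncomputable def equiv (hB : IsSelfDualForm N B) :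
    herm S₀ S₁ V ≃ₗ[ℝ] Module.Dual ℝ (herm S₀ S₁ V) :=
  LinearEquiv.ofInjectiveOfFinrankEq B hB.injective Subspace.dual_finrank_eq.symm

theorem equiv_symm (hB : IsSelfDualForm N B) (ξ : Module.Dual ℝ (herm S₀ S₁ V)) :
    B (hB.equiv.symm ξ) = ξ :=
  hB.equiv.apply_symm_apply ξ

theorem symm_mem_closedCone (hB : IsSelfDualForm N B) {ξ : Module.Dual ℝ (herm S₀ S₁ V)}
    (hξ : ∀ X ∈ N.closedCone, 0 ≤ ξ X) : hB.equiv.symm ξ ∈ N.closedCone := by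
  -- The trace is strictly positive on the closed cone away from `0`, so adding a small multiple of
  -- it moves `ξ` into the adjoint cone.
  refine mem_closure_of_forall_add_smul_mem (y := hB.equiv.symm (trace S₀ S₁ V)) fun ε hε => ?_
  have : ξ + ε • trace S₀ S₁ V ∈ adjointCone N.cone := fun X hX h0 => by
    have h1 := hξ X hX
    have h2 := hB.isEuclidean.trace_pos hX h0
    simp only [LinearMap.add_apply, LinearMap.smul_apply, smul_eq_mul]
    positivity
  rw [hB.adjointCone_eq] at this
  obtain ⟨c, hc, e⟩ := this
  convert hc
  apply hB.injective
  simp only [map_add, map_smul, equiv_symm]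
  exact e.symm

theorem nonneg (hB : IsSelfDualForm N B) {X Y : herm S₀ S₁ V} (hX : X ∈ N.closedCone)
    (hY : Y ∈ N.closedCone) : 0 ≤ B X Y := by
  refine nonneg_of_mem_closure (B.flip Y) (fun Z hZ => ?_) hX
  have : B Z ∈ adjointCone N.cone := by
    rw [hB.adjointCone_eq]; exact ⟨Z, hZ, rfl⟩
  by_cases h0 : Y = 0
  · simp [h0]
  · exact (this Y hY h0).le

/-- The face of the cone opposite to a transform of a diagonal unit has dimension at least
`dim E + 2`, that of the face opposite to an element representing `X ↦ x₁` at most `dim V + 2`. -/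
theorem finrank_le (hB : IsSelfDualForm N B) {E : Type*} [AddCommGroup E] [Module ℝ E]
    [FiniteDimensional ℝ E] (Φ : ℝ × E × ℝ →ₗ[ℝ] Module.Dual ℝ (herm S₀ S₁ V))
    (hΦ : Function.Injective Φ) (c : herm S₀ S₁ V) (s : S₀) {μ : ℝ} (hμ : μ ≠ 0)
    (hc : ∀ X, B c X = μ * (N.rho (unip s 0 0) X).1.a11)
    (h1 : ∀ t : E, ∃ r : ℝ, (∀ X ∈ N.closedCone, 0 ≤ Φ (1, t, r) X) ∧ Φ (1, t, r) c = 0)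
    (h2 : (∀ X ∈ N.closedCone, 0 ≤ Φ (0, 0, 1) X) ∧ Φ (0, 0, 1) c = 0) :
    Module.finrank ℝ E ≤ Module.finrank ℝ V := by
  have hE := hB.isEuclidean
  set Ψ : ℝ × E × ℝ →ₗ[ℝ] herm S₀ S₁ V :=
    N.rho (unip s 0 0) ∘ₗ hB.equiv.symm.toLinearMap ∘ₗ Φ with hΨ
  have key : ∀ w, (∀ X ∈ N.closedCone, 0 ≤ Φ w X) → Φ w c = 0 →
      e11 S₀ S₁ V (Ψ w) = 0 ∧ e12 S₀ S₁ V (Ψ w) = 0 ∧ e13 S₀ S₁ V (Ψ w) = 0 := by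
    intro w hw hwc
    have m : Ψ w ∈ N.closedCone :=
      N.rho_mem_closedCone (unip_mem_groupG _ _ _) (hB.symm_mem_closedCone hw)
    have z : (Ψ w).1.a11 = 0 := by
      have h := hc (hB.equiv.symm (Φ w))
      -- Symmetry of `B` turns vanishing of the form at `c` into vanishing of the transformed
      -- corner; the `2 × 2` minors then kill the rest of the first row.
      have hs := hB.isSymm.eq c (hB.equiv.symm (Φ w))
      rw [equiv_symm, hwc] at hs
      rw [hs] at h
      exact (mul_eq_zero.1 h.symm).resolve_left hμ
    have k1 := hE.norm_a12_le m
    have k2 := hE.norm_a13_le m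
    rw [z, zero_mul] at k1 k2
    exact ⟨z, hE.eq_zero₀ k1, hE.eq_zero₁ k2⟩
  have all : ∀ w, e11 S₀ S₁ V (Ψ w) = 0 ∧ e12 S₀ S₁ V (Ψ w) = 0 ∧ e13 S₀ S₁ V (Ψ w) = 0 := by
    rintro ⟨a, t, b⟩
    obtain ⟨r, hr, hrc⟩ := h1 t
    obtain ⟨r', hr', hrc'⟩ := h1 0
    obtain ⟨a1, a2, a3⟩ := key _ hr hrc
    obtain ⟨b1, b2, b3⟩ := key _ hr' hrc'
    obtain ⟨c1, c2, c3⟩ := key _ h2.1 h2.2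
    -- The vectors `(1, t, r)` given by the hypothesis, together with `(0, 0, 1)`, span the whole
    -- source, so linearity extends the vanishing from the face to its span.
    have e : ((a, t, b) : ℝ × E × ℝ) = (1, t, r) + (a - 1) • (1, 0, r') +
        (b - r - (a - 1) * r') • (0, 0, 1) := by
      simp
    rw [e]
    simp only [map_add, map_smul, a1, a2, a3, b1, b2, b3, c1, c2, c3, smul_zero, add_zero,
      and_self]
  have hinj : Function.Injective Ψ := by
    refine Function.Injective.comp (g := N.rho (unip s 0 0)) ?_
      (hB.equiv.symm.injective.comp hΦ)
    exact Function.LeftInverse.injective fun X => (N.rho_unip_neg s 0 0 X).2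
  set Λ : ℝ × E × ℝ →ₗ[ℝ] ℝ × V × ℝ :=
    ((e22 S₀ S₁ V).prod ((e23 S₀ S₁ V).prod (e33 S₀ S₁ V))) ∘ₗ Ψ with hΛ
  have hΛi : Function.Injective Λ := by
    rw [← LinearMap.ker_eq_bot, LinearMap.ker_eq_bot']
    intro w hw
    have h22 : (Ψ w).1.a22 = 0 := congrArg (fun z => z.1) hw
    have h23 : (Ψ w).1.a23 = 0 := congrArg (fun z => z.2.1) hw
    have h33 : (Ψ w).1.a33 = 0 := congrArg (fun z => z.2.2) hw
    obtain ⟨h11, h12, h13⟩ := all w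
    refine hinj ?_
    rw [map_zero]
    exact herm_ext h11 h12 h13 h22 h23 h33
  have := LinearMap.finrank_le_finrank_of_injective hΛi
  simp only [Module.finrank_prod, Module.finrank_self] at this
  omega

end IsSelfDualForm

end SpecialNilAlgebra

namespace SpecialNilAlgebra

open TMat

variable {S₀ S₁ V : Type*} [AddCommGroup S₀] [Module ℝ S₀] [FiniteDimensional ℝ S₀]
    [AddCommGroup S₁] [Module ℝ S₁] [FiniteDimensional ℝ S₁]
    [AddCommGroup V] [Module ℝ V] [FiniteDimensional ℝ V]
    {N : SpecialNilAlgebra S₀ S₁ V}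

/-! ### Matching extreme rays and the bound `dim S₀ ≤ dim V` -/

namespace IsSelfDualForm

variable {B : LinearMap.BilinForm ℝ (herm S₀ S₁ V)}

/-- The element representing `X ↦ ρ_U(X)₁` is a multiple of a transform of a diagonal unit. -/
theorem exists_smul_rho_a11 (hB : IsSelfDualForm N B) (s : S₀) :
    ∃ (μ : ℝ) (c : herm S₀ S₁ V), μ ≠ 0 ∧
      (∀ X, B c X = μ * (N.rho (unip s 0 0) X).1.a11) ∧
      (c = mkHerm 1 0 0 0 0 0 ∨ (∃ r, c = N.rho (unip r 0 0) (mkHerm 0 0 0 1 0 0)) ∨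
        ∃ p q, c = N.rho (unip 0 p q) (mkHerm 0 0 0 0 0 1)) := by
  have hE := hB.isEuclidean
  set ξ : Module.Dual ℝ (herm S₀ S₁ V) := e11 S₀ S₁ V ∘ₗ N.rho (unip s 0 0) with hξ
  have hξ0 : ∀ X ∈ N.closedCone, 0 ≤ ξ X := fun X hX => hE.rho_unip_a11_nonneg hX s 0 0
  set f := hB.equiv.symm ξ with hf
  have hBf : B f = ξ := hB.equiv_symm ξ
  obtain ⟨c₁, c₂, c₃, e, h1, h2, h3⟩ := hE.exists_eq_add_add (hB.symm_mem_closedCone hξ0)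
  have m1 : c₁ ∈ N.closedCone := by
    obtain ⟨a, ha, rfl⟩ := h1
    exact N.mkHerm_diag_mem_closedCone ha le_rfl le_rfl
  have zero : (0 : herm S₀ S₁ V) ∈ N.closedCone :=
    N.mkHerm_diag_mem_closedCone le_rfl le_rfl le_rfl
  have m2 : c₂ ∈ N.closedCone := by
    obtain rfl | ⟨t, ht, r, rfl⟩ := h2
    · exact zero
    · exact N.smul_mem_closedCone ht (N.rho_mem_closedCone (unip_mem_groupG _ _ _)
        (N.mkHerm_diag_mem_closedCone le_rfl zero_le_one le_rfl))
  have m3 : c₃ ∈ N.closedCone := by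
    obtain rfl | ⟨t, ht, p, q, rfl⟩ := h3
    · exact zero
    · exact N.smul_mem_closedCone ht (N.rho_mem_closedCone (unip_mem_groupG _ _ _)
        (N.mkHerm_diag_mem_closedCone le_rfl le_rfl zero_le_one))
  have hsum : ∀ X, B c₁ X + B c₂ X + B c₃ X = (N.rho (unip s 0 0) X).1.a11 := fun X => by
    have : B f X = ξ X := by rw [hBf]
    rw [hf, e] at this
    simp only [map_add, LinearMap.add_apply] at this
    exact this
  have nn : ∀ c ∈ N.closedCone, ∀ X ∈ N.closedCone, 0 ≤ B c X := fun c hc X hX =>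
    hB.nonneg hc hX
  -- The three summands give nonnegative forms adding up to a form on an extreme ray, so each of
  -- them is a multiple of it.
  have l1 := eq_smul_rho_a11_of_le (N := N) (B c₁) s (nn _ m1) fun X hX => by
    linarith [hsum X, nn _ m2 X hX, nn _ m3 X hX]
  have l2 := eq_smul_rho_a11_of_le (N := N) (B c₂) s (nn _ m2) fun X hX => by
    linarith [hsum X, nn _ m1 X hX, nn _ m3 X hX]
  have l3 := eq_smul_rho_a11_of_le (N := N) (B c₃) s (nn _ m3) fun X hX => by
    linarith [hsum X, nn _ m1 X hX, nn _ m2 X hX]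
  obtain ⟨μ₁, l1⟩ := l1
  obtain ⟨μ₂, l2⟩ := l2
  obtain ⟨μ₃, l3⟩ := l3
  -- Evaluation at the first unit; hence at least one multiple is nonzero.
  have hone : μ₁ + μ₂ + μ₃ = 1 := by
    have h := hsum (mkHerm 1 0 0 0 0 0)
    have k : (N.rho (unip s 0 0) (mkHerm 1 0 0 0 0 0)).1.a11 = 1 := by
      rw [rho_unip_a11]; simp [mkHerm]
    rw [l1, l2, l3, k] at h
    linarith
  have nonzero : ∀ (μ : ℝ) (c : herm S₀ S₁ V), μ ≠ 0 →
      (∀ X, B c X = μ * (N.rho (unip s 0 0) X).1.a11) → c ≠ 0 := by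
    rintro μ c hμ hc rfl
    have := hc (mkHerm 1 0 0 0 0 0)
    rw [rho_unip_a11] at this
    simp [mkHerm] at this
    exact hμ this.symm
  have scale : ∀ (μ t : ℝ) (c : herm S₀ S₁ V), t ≠ 0 →
      (∀ X, B (t • c) X = μ * (N.rho (unip s 0 0) X).1.a11) →
      ∀ X, B c X = (t⁻¹ * μ) * (N.rho (unip s 0 0) X).1.a11 := by
    intro μ t c ht hc X
    have := hc X
    simp only [map_smul, LinearMap.smul_apply, smul_eq_mul] at this
    rw [mul_assoc, ← this, inv_mul_cancel_left₀ ht]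
  by_cases z1 : μ₁ = 0
  · by_cases z2 : μ₂ = 0
    · have z3 : μ₃ ≠ 0 := by rintro rfl; simp [z1, z2] at hone
      obtain rfl | ⟨t, ht, p, q, rfl⟩ := h3
      · exact absurd rfl (nonzero _ _ z3 l3)
      · exact ⟨_, _, mul_ne_zero (inv_ne_zero ht.ne') z3, scale _ _ _ ht.ne' l3,
          Or.inr (Or.inr ⟨p, q, rfl⟩)⟩
    · obtain rfl | ⟨t, ht, r, rfl⟩ := h2
      · exact absurd rfl (nonzero _ _ z2 l2)
      · exact ⟨_, _, mul_ne_zero (inv_ne_zero ht.ne') z2, scale _ _ _ ht.ne' l2,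
          Or.inr (Or.inl ⟨r, rfl⟩)⟩
  · obtain ⟨a, ha, rfl⟩ := h1
    have ha0 : a ≠ 0 := by
      rintro rfl
      exact nonzero _ _ z1 l1 rfl
    have ea : mkHerm a (0 : S₀) (0 : S₁) 0 (0 : V) 0 = a • mkHerm 1 0 0 0 0 0 := by
      apply herm_ext <;> simp [mkHerm]
    rw [ea] at l1
    exact ⟨_, _, mul_ne_zero (inv_ne_zero ha0) z1, scale _ _ _ ha0 l1, Or.inl rfl⟩

/-- After undoing the transform, corners of conjugates by matrices with only the `13` entry `t`,
together with `x₃`, are dual forms vanishing on the second unit. They span `dim S₁ + 2` dimensions.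
-/
theorem finrank_le_of_rho_unip₂ (hB : IsSelfDualForm N B) (s r : S₀) {μ : ℝ} (hμ : μ ≠ 0)
    (hc : ∀ X, B (N.rho (unip r 0 0) (mkHerm 0 0 0 1 0 0)) X =
      μ * (N.rho (unip s 0 0) X).1.a11) :
    Module.finrank ℝ S₁ ≤ Module.finrank ℝ V := by
  have hE := hB.isEuclidean
  set U : TMat S₀ S₁ V := unip (-r) (N.mu r 0 - 0) (-0) with hU
  have hr := N.rho_unip_neg r 0 0
  rw [← hU] at hr
  have hm : ∀ X ∈ N.closedCone, N.rho U X ∈ N.closedCone := fun X hX =>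
    N.rho_mem_closedCone (unip_mem_groupG _ _ _) hX
  let Φ : ℝ × S₁ × ℝ →ₗ[ℝ] Module.Dual ℝ (herm S₀ S₁ V) := LinearMap.mk₂ ℝ
    (fun w X => w.1 * (N.rho U X).1.a11 + 2 * N.g₁ w.2.1 (N.rho U X).1.a13 +
      w.2.2 * (N.rho U X).1.a33)
    (fun w w' X => by simp; ring) (fun c w X => by simp; ring)
    (fun w X X' => by simp; ring) (fun c w X => by simp; ring)
  have hΦ : ∀ w X, Φ w X = w.1 * (N.rho U X).1.a11 + 2 * N.g₁ w.2.1 (N.rho U X).1.a13 +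
      w.2.2 * (N.rho U X).1.a33 := fun _ _ => rfl
  -- With `r = |t|²` the form is the corner after applying `unip 0 t 0`, hence nonnegative on the
  -- closed cone.
  refine hB.finrank_le Φ ?_ _ s hμ hc (fun t => ⟨N.g₁ t t, fun X hX => ?_, ?_⟩)
    ⟨fun X hX => ?_, ?_⟩
  · rw [← LinearMap.ker_eq_bot, LinearMap.ker_eq_bot']
    rintro ⟨a, t, b⟩ hw
    have ev : ∀ Y : herm S₀ S₁ V, a * Y.1.a11 + 2 * N.g₁ t Y.1.a13 + b * Y.1.a33 = 0 := fun Y => by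
      have := congrArg (fun ξ => ξ (N.rho (unip r 0 0) Y)) hw
      simpa [hΦ, (hr Y).2] using this
    have v1 := ev (mkHerm 1 0 0 0 0 0)
    have v2 := ev (mkHerm 0 0 t 0 0 0)
    have v3 := ev (mkHerm 0 0 0 0 0 1)
    simp [mkHerm] at v1 v2 v3
    have : t = 0 := hE.eq_zero₁ v2.le
    simp [v1, v3, this]
  · have := hE.rho_unip_a11_nonneg (hm X hX) 0 t 0
    rw [rho_unip_a11] at this
    rw [hΦ]
    simp at this ⊢
    linarith
  · rw [hΦ, (hr _).2]; simp [mkHerm]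
  · rw [hΦ]
    simpa using (hE.diag_nonneg (hm X hX)).2.2
  · rw [hΦ, (hr _).2]; simp [mkHerm]

/-- The same face count at the third unit, where the `12` entry and `x₂` supply the vanishing forms.
-/
theorem finrank_le_of_rho_unip₃ (hB : IsSelfDualForm N B) (s : S₀) (p : S₁) (q : V) {μ : ℝ}
    (hμ : μ ≠ 0) (hc : ∀ X, B (N.rho (unip 0 p q) (mkHerm 0 0 0 0 0 1)) X =
      μ * (N.rho (unip s 0 0) X).1.a11) :
    Module.finrank ℝ S₀ ≤ Module.finrank ℝ V := by
  have hE := hB.isEuclidean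
  set U : TMat S₀ S₁ V := unip (-0) (N.mu 0 q - p) (-q) with hU
  have hr := N.rho_unip_neg 0 p q
  rw [← hU] at hr
  have hm : ∀ X ∈ N.closedCone, N.rho U X ∈ N.closedCone := fun X hX =>
    N.rho_mem_closedCone (unip_mem_groupG _ _ _) hX
  let Φ : ℝ × S₀ × ℝ →ₗ[ℝ] Module.Dual ℝ (herm S₀ S₁ V) := LinearMap.mk₂ ℝ
    (fun w X => w.1 * (N.rho U X).1.a11 + 2 * N.g₀ w.2.1 (N.rho U X).1.a12 +
      w.2.2 * (N.rho U X).1.a22)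
    (fun w w' X => by simp; ring) (fun c w X => by simp; ring)
    (fun w X X' => by simp; ring) (fun c w X => by simp; ring)
  have hΦ : ∀ w X, Φ w X = w.1 * (N.rho U X).1.a11 + 2 * N.g₀ w.2.1 (N.rho U X).1.a12 +
      w.2.2 * (N.rho U X).1.a22 := fun _ _ => rfl
  refine hB.finrank_le Φ ?_ _ s hμ hc (fun t => ⟨N.g₀ t t, fun X hX => ?_, ?_⟩)
    ⟨fun X hX => ?_, ?_⟩
  · rw [← LinearMap.ker_eq_bot, LinearMap.ker_eq_bot']
    rintro ⟨a, t, b⟩ hw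
    have ev : ∀ Y : herm S₀ S₁ V, a * Y.1.a11 + 2 * N.g₀ t Y.1.a12 + b * Y.1.a22 = 0 := fun Y => by
      have := congrArg (fun ξ => ξ (N.rho (unip 0 p q) Y)) hw
      simpa [hΦ, (hr Y).2] using this
    have v1 := ev (mkHerm 1 0 0 0 0 0)
    have v2 := ev (mkHerm 0 t 0 0 0 0)
    have v3 := ev (mkHerm 0 0 0 1 0 0)
    simp [mkHerm] at v1 v2 v3
    have : t = 0 := hE.eq_zero₀ v2.le
    simp [v1, v3, this]
  · have := hE.rho_unip_a11_nonneg (hm X hX) t 0 0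
    rw [rho_unip_a11] at this
    rw [hΦ]
    simp at this ⊢
    linarith
  · rw [hΦ, (hr _).2]; simp [mkHerm]
  · rw [hΦ]
    simpa using (hE.diag_nonneg (hm X hX)).2.1
  · rw [hΦ, (hr _).2]; simp [mkHerm]

theorem finrank_S₀_le (hB : IsSelfDualForm N B) [Nontrivial S₀] :
    Module.finrank ℝ S₀ ≤ Module.finrank ℝ V := by
  by_contra hlt
  have key : ∀ s : S₀, ∃ μ : ℝ, μ ≠ 0 ∧
      ∀ X, B (mkHerm 1 0 0 0 0 0) X = μ * (N.rho (unip s 0 0) X).1.a11 := fun s => by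
    obtain ⟨μ, c, hμ, hc, rfl | ⟨r, rfl⟩ | ⟨p, q, rfl⟩⟩ := hB.exists_smul_rho_a11 s
    · exact ⟨μ, hμ, hc⟩
    · exact absurd (N.dim_eq.trans_le (hB.finrank_le_of_rho_unip₂ s r hμ hc)) hlt
    · exact absurd (hB.finrank_le_of_rho_unip₃ s p q hμ hc) hlt
  obtain ⟨s, hs⟩ := exists_ne (0 : S₀)
  obtain ⟨μ, hμ, h⟩ := key s
  obtain ⟨μ', -, h'⟩ := key 0
  -- The corner of the transformed second unit is `|s|²`, but `0` for the trivial transform: the two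
  -- forms are not proportional.
  have k := h (mkHerm 0 0 0 1 0 0)
  rw [h', rho_unip_a11, rho_unip_a11] at k
  simp [mkHerm] at k
  exact k.elim hμ (hB.isEuclidean.pos₀ s hs).ne'

end IsSelfDualForm

/-! ### From equality of dimensions to isometry -/

/-- A linear map that is isometric up to a positive factor, between Euclidean spaces of the same
dimension, shows that they are isometric. -/
theorem equivalent_of_similarity {E F : Type*} [AddCommGroup E] [Module ℝ E]
    [FiniteDimensional ℝ E] [AddCommGroup F] [Module ℝ F] [FiniteDimensional ℝ F]
    {g : LinearMap.BilinForm ℝ E} {g' : LinearMap.BilinForm ℝ F} (f : E →ₗ[ℝ] F) {c : ℝ}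
    (hc : 0 < c) (hf : ∀ x, g' (f x) (f x) = c * g x x) (hg : ∀ x, x ≠ 0 → 0 < g x x)
    (hd : Module.finrank ℝ E = Module.finrank ℝ F) :
    g.toQuadraticMap.Equivalent g'.toQuadraticMap := by
  have hs : 0 < √c := Real.sqrt_pos.2 hc
  have hinj : Function.Injective ((√c)⁻¹ • f) := by
    rw [← LinearMap.ker_eq_bot, LinearMap.ker_eq_bot']
    intro x hx
    by_contra h0
    have h1 : f x = 0 := (smul_eq_zero.1 hx).resolve_left (inv_ne_zero hs.ne')
    have h2 := hf x
    rw [h1, map_zero] at h2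
    exact (mul_pos hc (hg x h0)).ne h2
  refine ⟨⟨LinearEquiv.ofInjectiveOfFinrankEq _ hinj hd, fun x => ?_⟩⟩
  have : LinearEquiv.ofInjectiveOfFinrankEq _ hinj hd x = (√c)⁻¹ • f x := rfl
  change g'.toQuadraticMap (LinearEquiv.ofInjectiveOfFinrankEq _ hinj hd x) = _
  rw [this]
  simp only [LinearMap.BilinMap.toQuadraticMap_apply, map_smul, LinearMap.smul_apply, smul_eq_mul,
    hf]
  field_simp
  rw [Real.sq_sqrt hc.le]

theorem IsEuclidean.finrank_V_le [Nontrivial S₀] (h : N.IsEuclidean) :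
    Module.finrank ℝ V ≤ Module.finrank ℝ S₀ := by
  obtain ⟨s, hs⟩ := exists_ne (0 : S₀)
  rw [N.dim_eq]
  refine LinearMap.finrank_le_finrank_of_injective (f := N.mu s) ?_
  rw [← LinearMap.ker_eq_bot, LinearMap.ker_eq_bot']
  intro v hv
  have := N.isometric s v
  rw [hv, map_zero] at this
  exact h.eq_zeroV (((mul_eq_zero.1 this.symm).resolve_left (h.pos₀ s hs).ne').le)

theorem IsSelfDualForm.isomorphicEuclidean {B : LinearMap.BilinForm ℝ (herm S₀ S₁ V)}
    (hB : IsSelfDualForm N B) (hV : Subsingleton S₀ → Subsingleton V) :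
    N.IsomorphicEuclidean := by
  have hE := hB.isEuclidean
  have p0 : N.g₀.toQuadraticMap.PosDef := fun x hx => by simpa using hE.pos₀ x hx
  have p1 : N.g₁.toQuadraticMap.PosDef := fun x hx => by simpa using hE.pos₁ x hx
  have pV : N.gV.toQuadraticMap.PosDef := fun x hx => by simpa using hE.posV x hx
  refine ⟨pV, p0, p1, ?_⟩
  rcases subsingleton_or_nontrivial S₀ with h0 | h0
  -- Only here is the excluded case needed: all three spaces are zero, and the zero map is an
  -- isometry.
  · have := hV h0
    have d0 : Module.finrank ℝ S₀ = 0 := Module.finrank_zero_of_subsingleton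
    have dV : Module.finrank ℝ V = 0 := Module.finrank_zero_of_subsingleton
    refine ⟨equivalent_of_similarity 0 one_pos (fun x => ?_) hE.posV (dV.trans d0.symm),
      equivalent_of_similarity 0 one_pos (fun x => ?_) hE.pos₀ N.dim_eq⟩
    · simp [Subsingleton.elim x 0]
    · simp [Subsingleton.elim x 0]
  · have d : Module.finrank ℝ V = Module.finrank ℝ S₀ :=
      le_antisymm hE.finrank_V_le hB.finrank_S₀_le
    have hV : Nontrivial V := by
      rw [← Module.finrank_pos_iff (R := ℝ), d]
      exact Module.finrank_pos
    obtain ⟨s, hs⟩ := exists_ne (0 : S₀)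
    obtain ⟨v, hv⟩ := exists_ne (0 : V)
    have e1 : N.gV.toQuadraticMap.Equivalent N.g₁.toQuadraticMap :=
      equivalent_of_similarity (N.mu s) (hE.pos₀ s hs) (N.isometric s) hE.posV (d.trans N.dim_eq)
    have e0 : N.g₀.toQuadraticMap.Equivalent N.g₁.toQuadraticMap :=
      equivalent_of_similarity (N.mu.flip v) (hE.posV v hv)
        (fun t => (N.isometric t v).trans (mul_comm _ _)) hE.pos₀ N.dim_eq
    exact ⟨e1.trans e0.symm, e0⟩

end SpecialNilAlgebra

namespace SpecialNilAlgebra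

open TMat

variable {S₀ S₁ V : Type*} [AddCommGroup S₀] [Module ℝ S₀] [FiniteDimensional ℝ S₀]
    [AddCommGroup S₁] [Module ℝ S₁] [FiniteDimensional ℝ S₁]
    [AddCommGroup V] [Module ℝ V] [FiniteDimensional ℝ V]
    {N : SpecialNilAlgebra S₀ S₁ V}

/-! ### The case of isomorphic Euclidean spaces -/

theorem IsomorphicEuclidean.isEuclidean (h : N.IsomorphicEuclidean) : N.IsEuclidean :=
  ⟨fun x hx => by simpa using h.2.1 x hx, fun x hx => by simpa using h.2.2.1 x hx,
    fun x hx => by simpa using h.1 x hx⟩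

/-- Since `dim V = dim S₁`, the injective map `μ(s, ·)` is onto for `s ≠ 0`, and on its image the
adjoint is multiplication by `|s|²`. -/
theorem IsomorphicEuclidean.norm_flatMul (h : N.IsomorphicEuclidean) (s : S₀) (p : S₁) :
    N.gV (N.flatMul s p) (N.flatMul s p) = N.g₀ s s * N.g₁ p p := by
  by_cases hs : s = 0
  · simp [hs, flatMul_zero_left]
  have hd : Module.finrank ℝ V = Module.finrank ℝ S₁ := by
    obtain ⟨e⟩ := h.2.2.2.1
    rw [← N.dim_eq]; exact e.toLinearEquiv.finrank_eq
  have hinj : Function.Injective (N.mu s) := by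
    rw [← LinearMap.ker_eq_bot, LinearMap.ker_eq_bot']
    intro v hv
    have := N.isometric s v
    rw [hv, map_zero] at this
    exact h.isEuclidean.eq_zeroV
      (((mul_eq_zero.1 this.symm).resolve_left (h.isEuclidean.pos₀ s hs).ne').le)
  obtain ⟨v, rfl⟩ := (LinearMap.injective_iff_surjective_of_finrank_eq_finrank hd).1 hinj p
  rw [flatMul_mu_self, N.isometric]
  simp only [map_smul, LinearMap.smul_apply, smul_eq_mul]

theorem IsomorphicEuclidean.d_eq_d' (h : N.IsomorphicEuclidean) (X : herm S₀ S₁ V) :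
    N.d X = N.d' X := by
  rw [d', h.norm_flatMul, sub_self, zero_div, add_zero]

theorem d_eq_d'_of_subsingleton [Subsingleton S₀] (X : herm S₀ S₁ V) : N.d X = N.d' X := by
  rw [d', Subsingleton.elim X.1.a12 0]
  simp [flatMul_zero_left]

/-! ### Cholesky decompositions from positive minors -/

/-- The counterpart of `a11_mul_d'`, eliminating the last row and column. No correction term appears
because `|s₁ · v^♭|² = |s₁|²|v|²`. -/
theorem a33_mul_d (N : SpecialNilAlgebra S₀ S₁ V) (X : herm S₀ S₁ V) :
    X.1.a33 * N.d X = (X.1.a22 * X.1.a33 - N.gV X.1.a23 X.1.a23) *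
      (X.1.a11 * X.1.a33 - N.g₁ X.1.a13 X.1.a13) -
      N.g₀ (X.1.a33 • X.1.a12 - N.mulVFlat X.1.a13 X.1.a23)
        (X.1.a33 • X.1.a12 - N.mulVFlat X.1.a13 X.1.a23) := by
  have c0 := N.symm₀.eq X.1.a12 (N.mulVFlat X.1.a13 X.1.a23)
  simp only [d, map_sub, LinearMap.sub_apply, map_smul, LinearMap.smul_apply, smul_eq_mul,
    norm_mulVFlat, g₁_mu, ← c0]
  ring

/-- Cholesky decomposition `X = A · A^*`. -/
theorem mem_cone_of_pos {X : herm S₀ S₁ V} (h3 : 0 < X.1.a33)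
    (h2 : N.gV X.1.a23 X.1.a23 < X.1.a22 * X.1.a33) (hd : 0 < N.d X) : X ∈ N.cone := by
  set c := √X.1.a33 with hc
  have hc0 : 0 < c := Real.sqrt_pos.2 h3
  have hcc : c ^ 2 = X.1.a33 := Real.sq_sqrt h3.le
  have hb1 : 0 < X.1.a22 - N.gV X.1.a23 X.1.a23 / c ^ 2 := by
    rw [sub_pos, hcc, div_lt_iff₀ h3]; exact h2
  set b := √(X.1.a22 - N.gV X.1.a23 X.1.a23 / c ^ 2) with hb
  have hb0 : 0 < b := Real.sqrt_pos.2 hb1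
  have hbb : b ^ 2 = X.1.a22 - N.gV X.1.a23 X.1.a23 / c ^ 2 := Real.sq_sqrt hb1.le
  set w := X.1.a12 - (c ^ 2)⁻¹ • N.mulVFlat X.1.a13 X.1.a23 with hw
  have hww : X.1.a33 • X.1.a12 - N.mulVFlat X.1.a13 X.1.a23 = c ^ 2 • w := by
    rw [hw, smul_sub, smul_smul, mul_inv_cancel₀ (by positivity), one_smul, hcc]
  -- The pivots are found from the bottom right corner upwards; by `a33_mul_d` the last one equals
  -- `d / (c² b²)`.
  have ha1 : 0 < X.1.a11 - N.g₁ X.1.a13 X.1.a13 / c ^ 2 - N.g₀ w w / b ^ 2 := by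
    have k := N.a33_mul_d X
    rw [hww, ← hcc] at k
    have k2 : X.1.a22 = b ^ 2 + N.gV X.1.a23 X.1.a23 / c ^ 2 := by rw [hbb]; ring
    rw [k2] at k
    simp only [map_smul, LinearMap.smul_apply, smul_eq_mul] at k
    have e : X.1.a11 - N.g₁ X.1.a13 X.1.a13 / c ^ 2 - N.g₀ w w / b ^ 2 =
        N.d X / (c ^ 2 * b ^ 2) := by
      rw [eq_div_iff (by positivity)]
      refine mul_left_cancel₀ (a := c ^ 2) (by positivity) ?_
      rw [k]
      field_simp
      ring
    rw [e]; positivity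
  set a := √(X.1.a11 - N.g₁ X.1.a13 X.1.a13 / c ^ 2 - N.g₀ w w / b ^ 2) with ha
  have ha0 : 0 < a := Real.sqrt_pos.2 ha1
  have haa : a ^ 2 = X.1.a11 - N.g₁ X.1.a13 X.1.a13 / c ^ 2 - N.g₀ w w / b ^ 2 :=
    Real.sq_sqrt ha1.le
  refine ⟨⟨a, b⁻¹ • w, c⁻¹ • X.1.a13, 0, b, c⁻¹ • X.1.a23, 0, 0, c⟩,
    ⟨rfl, rfl, rfl, ha0, hb0, hc0⟩, ?_⟩
  obtain ⟨x21, x31, x32⟩ := herm_lower X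
  have hcc' := hcc
  rw [sq] at hcc'
  ext <;> simp [mulVFlat_zero_left, mulVFlat_zero_right, flatMul_zero_left, flatMul_zero_right,
    smul_smul, mulVFlat_smul_left, mulVFlat_smul_right, hb0.ne', hc0.ne', x21, x31, x32, hcc']
  · rw [← sq, haa]; field_simp; ring
  · rw [hw]; module
  · rw [hw]; module
  · rw [← sq, hbb]; field_simp; ring

/-- Cholesky decomposition `X = A^* · A`. -/
theorem exists_eq_adj_mul {X : herm S₀ S₁ V} (h1 : 0 < X.1.a11)
    (h2 : N.g₀ X.1.a12 X.1.a12 < X.1.a11 * X.1.a22) (hd : 0 < N.d' X) :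
    ∃ A ∈ groupG S₀ S₁ V, X = N.rho A.adj (hermOne S₀ S₁ V) := by
  set a := √X.1.a11 with ha
  have ha0 : 0 < a := Real.sqrt_pos.2 h1
  have haa : a ^ 2 = X.1.a11 := Real.sq_sqrt h1.le
  have hb1 : 0 < X.1.a22 - N.g₀ X.1.a12 X.1.a12 / a ^ 2 := by
    rw [sub_pos, haa, div_lt_iff₀ h1, mul_comm]; exact h2
  set b := √(X.1.a22 - N.g₀ X.1.a12 X.1.a12 / a ^ 2) with hb
  have hb0 : 0 < b := Real.sqrt_pos.2 hb1
  have hbb : b ^ 2 = X.1.a22 - N.g₀ X.1.a12 X.1.a12 / a ^ 2 := Real.sq_sqrt hb1.le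
  set w := X.1.a23 - (a ^ 2)⁻¹ • N.flatMul X.1.a12 X.1.a13 with hw
  have hww : X.1.a11 • X.1.a23 - N.flatMul X.1.a12 X.1.a13 = a ^ 2 • w := by
    rw [hw, smul_sub, smul_smul, mul_inv_cancel₀ (by positivity), one_smul, haa]
  -- Here elimination runs from the top left corner, and the last pivot is `d' / (a² b²)`.
  have hc1 : 0 < X.1.a33 - N.g₁ X.1.a13 X.1.a13 / a ^ 2 - N.gV w w / b ^ 2 := by
    have k := N.a11_mul_d' X h1.ne'
    rw [hww, ← haa] at k
    have k2 : X.1.a22 = b ^ 2 + N.g₀ X.1.a12 X.1.a12 / a ^ 2 := by rw [hbb]; ring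
    rw [k2] at k
    simp only [map_smul, LinearMap.smul_apply, smul_eq_mul] at k
    have e : X.1.a33 - N.g₁ X.1.a13 X.1.a13 / a ^ 2 - N.gV w w / b ^ 2 =
        N.d' X / (a ^ 2 * b ^ 2) := by
      rw [eq_div_iff (by positivity)]
      refine mul_left_cancel₀ (a := a ^ 2) (by positivity) ?_
      rw [k]
      field_simp
      ring
    rw [e]; positivity
  set c := √(X.1.a33 - N.g₁ X.1.a13 X.1.a13 / a ^ 2 - N.gV w w / b ^ 2) with hc
  have hc0 : 0 < c := Real.sqrt_pos.2 hc1
  have hcc : c ^ 2 = X.1.a33 - N.g₁ X.1.a13 X.1.a13 / a ^ 2 - N.gV w w / b ^ 2 :=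
    Real.sq_sqrt hc1.le
  refine ⟨⟨a, a⁻¹ • X.1.a12, a⁻¹ • X.1.a13, 0, b, b⁻¹ • w, 0, 0, c⟩,
    ⟨rfl, rfl, rfl, ha0, hb0, hc0⟩, ?_⟩
  obtain ⟨x21, x31, x32⟩ := herm_lower X
  apply Subtype.ext
  rw [rho_hermOne]
  have haa' := haa
  rw [sq] at haa'
  ext <;> simp [mulVFlat_zero_left, mulVFlat_zero_right, flatMul_zero_left, flatMul_zero_right,
    smul_smul, flatMul_smul_left, flatMul_smul_right, ha0.ne', hb0.ne', x21, x31, x32, haa']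
  · rw [← sq, hbb]; field_simp; ring
  · rw [hw]; module
  · rw [hw]; module
  · rw [← sq, hcc]; field_simp; ring

/-! ### The trace form and self-adjointness -/

/-- The trace form on Hermitian matrices. -/
noncomputable def traceForm (N : SpecialNilAlgebra S₀ S₁ V) :
    LinearMap.BilinForm ℝ (herm S₀ S₁ V) :=
  LinearMap.mk₂ ℝ (fun X Y => X.1.a11 * Y.1.a11 + X.1.a22 * Y.1.a22 + X.1.a33 * Y.1.a33 +
      2 * N.g₀ X.1.a12 Y.1.a12 + 2 * N.g₁ X.1.a13 Y.1.a13 + 2 * N.gV X.1.a23 Y.1.a23)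
    (fun X X' Y => by simp; ring) (fun c X Y => by simp; ring)
    (fun X Y Y' => by simp; ring) (fun c X Y => by simp; ring)

theorem traceForm_apply (X Y : herm S₀ S₁ V) : N.traceForm X Y =
    X.1.a11 * Y.1.a11 + X.1.a22 * Y.1.a22 + X.1.a33 * Y.1.a33 +
      2 * N.g₀ X.1.a12 Y.1.a12 + 2 * N.g₁ X.1.a13 Y.1.a13 + 2 * N.gV X.1.a23 Y.1.a23 := rfl

theorem traceForm_isSymm : N.traceForm.IsSymm := by
  refine ⟨fun X Y => ?_⟩
  have c0 := N.symm₀.eq X.1.a12 Y.1.a12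
  have c1 := N.symm₁.eq X.1.a13 Y.1.a13
  have cV := N.symmV.eq X.1.a23 Y.1.a23
  simp only [traceForm_apply, c0, c1, cV, RingHom.id_apply]
  ring

theorem IsEuclidean.traceForm_posDef (h : N.IsEuclidean) : N.traceForm.toQuadraticMap.PosDef := by
  intro X hX
  rw [LinearMap.BilinMap.toQuadraticMap_apply, traceForm_apply]
  have n0 := h.nonneg₀ X.1.a12
  have n1 := h.nonneg₁ X.1.a13
  have nV := h.nonnegV X.1.a23
  have q1 := mul_self_nonneg X.1.a11
  have q2 := mul_self_nonneg X.1.a22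
  have q3 := mul_self_nonneg X.1.a33
  by_contra! hle
  exact hX (herm_ext (mul_self_eq_zero.1 (by linarith)) (h.eq_zero₀ (by linarith))
    (h.eq_zero₁ (by linarith)) (mul_self_eq_zero.1 (by linarith)) (h.eq_zeroV (by linarith))
    (mul_self_eq_zero.1 (by linarith)))

/-- The trace of `ρ_A(X)` is the trace form of `A^* · A` and `X`. -/
theorem traceForm_rho_adj {A : TMat S₀ S₁ V} (hA : A.IsUpper) (X : herm S₀ S₁ V) :
    N.traceForm (N.rho A.adj (hermOne S₀ S₁ V)) X = trace S₀ S₁ V (N.rho A X) := by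
  obtain ⟨e1, e2, e3, e4, e5, e6⟩ := N.rho_upper _ hA X
  have ht : trace S₀ S₁ V (N.rho A X) =
    (N.rho A X).1.a11 + (N.rho A X).1.a22 + (N.rho A X).1.a33 := rfl
  obtain ⟨a1, a2, a3⟩ := hA
  rw [ht, e1, e4, e6, traceForm_apply, rho_hermOne]
  simp [a1, a2, a3, mulVFlat_zero_left, mulVFlat_zero_right, flatMul_zero_left, flatMul_zero_right,
    gV_flatMul]
  ring

/-- Back substitution from the `33` entry, using that the diagonal entries of `A` are nonzero. -/
theorem eq_zero_of_rho_eq_zero {A : TMat S₀ S₁ V} (hA : A ∈ groupG S₀ S₁ V) {X : herm S₀ S₁ V}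
    (hX : N.rho A X = 0) : X = 0 := by
  obtain ⟨e1, e2, e3, e4, e5, e6⟩ := N.rho_upper _ (isUpper_of_mem_groupG hA) X
  obtain ⟨-, -, -, h1, h2, h3⟩ := hA
  rw [hX] at e1 e2 e3 e4 e5 e6
  have z33 : X.1.a33 = 0 := by
    have : (0 : ℝ) = A.a33 ^ 2 * X.1.a33 := e6
    exact (mul_eq_zero.1 this.symm).resolve_left (by positivity)
  have z23 : X.1.a23 = 0 := by
    have : (0 : V) = _ := e5
    rw [z33] at this
    simpa [h2.ne', h3.ne'] using this.symm
  have z22 : X.1.a22 = 0 := by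
    have : (0 : ℝ) = _ := e4
    rw [z33, z23] at this
    simpa [h2.ne', h3.ne'] using this.symm
  have z13 : X.1.a13 = 0 := by
    have : (0 : S₁) = _ := e3
    rw [z33, z23] at this
    simpa [h1.ne', h3.ne'] using this.symm
  have z12 : X.1.a12 = 0 := by
    have : (0 : S₀) = _ := e2
    rw [z33, z23, z13, z22] at this
    simpa [h1.ne', h2.ne', mulVFlat_zero_left, mulVFlat_zero_right] using this.symm
  have z11 : X.1.a11 = 0 := by
    have : (0 : ℝ) = _ := e1
    rw [z33, z23, z13, z22, z12] at this
    simpa [h1.ne'] using this.symm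
  exact herm_ext z11 z12 z13 z22 z23 z33

theorem IsEuclidean.norm_a12_lt (h : N.IsEuclidean) {X : herm S₀ S₁ V} (hX : X ∈ N.cone) :
    N.g₀ X.1.a12 X.1.a12 < X.1.a11 * X.1.a22 :=
  lt_mul_of_forall_pos (h.diag_pos_of_mem_cone hX).2.1 fun s => by
    have := (h.diag_pos_of_mem_cone (N.rho_mem_cone (unip_mem_groupG s 0 0) hX)).1
    rw [rho_unip_a11] at this
    simpa using this

theorem d_pos_of_mem_cone {X : herm S₀ S₁ V} (hX : X ∈ N.cone) : 0 < N.d X := by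
  obtain ⟨A, hA, e⟩ := hX
  rw [N.d_eq_detG_sq hA e]
  obtain ⟨-, -, -, h1, h2, h3⟩ := hA
  rw [detG]; positivity

/-- An element of the adjoint cone is represented, with respect to the trace form, by a matrix
with positive minors. -/
theorem pos_of_traceForm_mem_adjointCone {Y : herm S₀ S₁ V}
    (hY : N.traceForm Y ∈ adjointCone N.cone) :
    0 < Y.1.a33 ∧ N.gV Y.1.a23 Y.1.a23 < Y.1.a22 * Y.1.a33 ∧ 0 < Y.1.a11 ∧ 0 < N.d' Y := by
  have hpos : ∀ X ∈ N.closedCone, X ≠ 0 → 0 < N.traceForm Y X := hY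
  have y1 : 0 < Y.1.a11 := by
    have := hpos _ (N.mkHerm_diag_mem_closedCone zero_le_one le_rfl le_rfl)
      fun h0 => one_ne_zero ((congrArg (e11 S₀ S₁ V) h0).trans (map_zero _))
    rw [traceForm_apply] at this
    simpa [mkHerm] using this
  have t2 : ∀ s, 0 < Y.1.a22 + Y.1.a11 * N.g₀ s s + 2 * N.g₀ s Y.1.a12 := fun s => by
    have := hpos _ (N.mkHerm₂_mem_closedCone s)
      fun h0 => one_ne_zero ((congrArg (e22 S₀ S₁ V) h0).trans (map_zero _))
    have c := N.symm₀.eq Y.1.a12 s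
    rw [traceForm_apply] at this
    simp [mkHerm, c] at this
    linarith
  have t3 : ∀ p q, 0 < Y.1.a33 + Y.1.a22 * N.gV q q + 2 * N.gV q Y.1.a23 +
      Y.1.a11 * N.g₁ p p + 2 * N.g₁ p (Y.1.a13 + N.mu Y.1.a12 q) := fun p q => by
    have := hpos _ (N.mkHerm₃_mem_closedCone p q)
      fun h0 => one_ne_zero ((congrArg (e33 S₀ S₁ V) h0).trans (map_zero _))
    have c1 := N.symm₁.eq Y.1.a13 p
    have c1' := N.symm₁.eq (N.mu Y.1.a12 q) p
    have cV := N.symmV.eq Y.1.a23 q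
    have k := N.g₁_mu Y.1.a12 q p
    rw [traceForm_apply] at this
    simp [mkHerm, c1, cV, ← k, c1'] at this ⊢
    linarith
  have m2 : N.g₀ Y.1.a12 Y.1.a12 < Y.1.a22 * Y.1.a11 := lt_mul_of_forall_pos y1 t2
  have y2 : 0 < Y.1.a22 := by simpa using t2 0
  have y3 : 0 < Y.1.a33 := by simpa using t3 0 0
  refine ⟨y3, ?_, y1, ?_⟩
  · rw [mul_comm]
    exact lt_mul_of_forall_pos y2 fun q => by simpa using t3 0 q
  set e := Y.1.a11 * Y.1.a22 - N.g₀ Y.1.a12 Y.1.a12 with he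
  have he0 : 0 < e := by rw [he]; linarith
  set w := Y.1.a11 • Y.1.a23 - N.flatMul Y.1.a12 Y.1.a13 with hw
  have k : N.gV w w < (Y.1.a11 * Y.1.a33 - N.g₁ Y.1.a13 Y.1.a13) * e :=
    lt_mul_of_forall_pos he0 fun q => by
      -- The `13` entry is chosen to minimize `t3` for fixed `q`; times `y₁`, this leaves a
      -- quadratic in `q` with coefficients from the block in `a11_mul_d'`.
      have := mul_pos y1 (t3 (-Y.1.a11⁻¹ • (Y.1.a13 + N.mu Y.1.a12 q)) q)
      have i := N.isometric Y.1.a12 q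
      have c1 := N.symm₁.eq (N.mu Y.1.a12 q) Y.1.a13
      have f := N.gV_flatMul Y.1.a12 Y.1.a13 q
      have cV := N.symmV.eq (N.flatMul Y.1.a12 Y.1.a13) q
      rw [f] at cV
      rw [hw, he]
      simp only [map_add, LinearMap.add_apply, map_smul, LinearMap.smul_apply, smul_eq_mul, i,
        map_sub, ← c1, ← cV] at this ⊢
      refine this.trans_eq ?_
      field_simp
      ring
  refine pos_of_mul_pos_right (a := Y.1.a11) ?_ y1.le
  rw [N.a11_mul_d' Y y1.ne']
  linarith

theorem IsomorphicEuclidean.isSelfAdjointCone (h : N.IsomorphicEuclidean) :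
    IsSelfAdjointCone N.cone := by
  have hE := h.isEuclidean
  have hp := hE.traceForm_posDef
  refine ⟨N.traceForm, traceForm_isSymm, hp, Set.Subset.antisymm (fun ξ hξ => ?_) ?_⟩
  · have hinj : Function.Injective N.traceForm := by
      rw [← LinearMap.ker_eq_bot, LinearMap.ker_eq_bot']
      intro X hX
      by_contra h0
      have := hp X h0
      rw [LinearMap.BilinMap.toQuadraticMap_apply, hX] at this
      exact lt_irrefl _ this
    obtain ⟨Y, rfl⟩ := (LinearMap.injective_iff_surjective_of_finrank_eq_finrank
      Subspace.dual_finrank_eq.symm).1 hinj ξ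
    obtain ⟨y3, m, -, hd⟩ := pos_of_traceForm_mem_adjointCone hξ
    -- Positivity as a dual form yields `d' > 0`, membership in the cone needs `d > 0`; the equality
    -- `d = d'` bridges the two.
    exact ⟨Y, mem_cone_of_pos y3 m (by rwa [h.d_eq_d']), rfl⟩
  · rintro _ ⟨Y, hY, rfl⟩
    obtain ⟨A, hA, rfl⟩ := exists_eq_adj_mul (hE.diag_pos_of_mem_cone hY).1 (hE.norm_a12_lt hY)
      (by rw [← h.d_eq_d']; exact d_pos_of_mem_cone hY)
    intro X hX h0
    change 0 < N.traceForm _ X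
    rw [traceForm_rho_adj (isUpper_of_mem_groupG hA)]
    exact hE.trace_pos (N.rho_mem_closedCone hA hX) fun h1 => h0 (eq_zero_of_rho_eq_zero hA h1)

end SpecialNilAlgebra

theorem mainTheorem4 {S₀ S₁ V : Type*}
    [AddCommGroup S₀] [Module ℝ S₀] [FiniteDimensional ℝ S₀]
    [AddCommGroup S₁] [Module ℝ S₁] [FiniteDimensional ℝ S₁]
    [AddCommGroup V] [Module ℝ V] [FiniteDimensional ℝ V]
    (N : SpecialNilAlgebra S₀ S₁ V) :
    -- `d` and `d'` are the squared `G`-determinants of the cone and of the dual cone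
    (∀ A ∈ TMat.groupG S₀ S₁ V, ∀ X : TMat.herm S₀ S₁ V,
      ((X : TMat S₀ S₁ V) = N.mul A A.adj → N.d X = A.detG ^ 2) ∧
      ((X : TMat S₀ S₁ V) = N.mul A.adj A → N.d' X = A.detG ^ 2)) ∧
    -- homogeneity of degree `3`
    (∀ (c : ℝ) (X : TMat.herm S₀ S₁ V), N.d (c • X) = c ^ 3 * N.d X) ∧
    (∀ (c : ℝ) (X : TMat.herm S₀ S₁ V), c ≠ 0 → (X : TMat S₀ S₁ V).a11 ≠ 0 →
      N.d' (c • X) = c ^ 3 * N.d' X) ∧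
    -- `d` is `G₀`-invariant
    (∀ A ∈ TMat.groupG0 S₀ S₁ V, ∀ X : TMat.herm S₀ S₁ V, N.d (N.rho A X) = N.d X) ∧
    -- the rational function `d'` is `G₀^*`-invariant (its domain is preserved)
    (∀ B ∈ TMat.groupG0Star S₀ S₁ V, ∀ X : TMat.herm S₀ S₁ V, (X : TMat S₀ S₁ V).a11 ≠ 0 →
      (N.rho B X : TMat S₀ S₁ V).a11 ≠ 0 ∧ N.d' (N.rho B X) = N.d' X) ∧
    -- criterion for self-adjointness (excluding only the case `S = 0`, `V ≠ 0`)
    ((Subsingleton S₀ → Subsingleton V) →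
      (IsSelfAdjointCone N.cone ↔ N.IsomorphicEuclidean)) ∧
    -- and then `d = d'`
    (IsSelfAdjointCone N.cone →
      ∀ X : TMat.herm S₀ S₁ V, (X : TMat S₀ S₁ V).a11 ≠ 0 → N.d X = N.d' X) := by
  refine ⟨fun A hA X => ⟨N.d_eq_detG_sq hA, N.d'_eq_detG_sq hA⟩, N.d_smul,
    fun c X hc hX => N.d'_smul hc X hX, ?_, ?_, fun hV => ⟨?_, fun h => h.isSelfAdjointCone⟩, ?_⟩
  · rintro A ⟨hA, hdet⟩ X
    rw [N.d_rho (SpecialNilAlgebra.isUpper_of_mem_groupG hA) hA.2.2.2.2.1.ne'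
      hA.2.2.2.2.2.ne', hdet]
    ring
  · rintro B ⟨A, ⟨hA, hdet⟩, rfl⟩ X hX
    have h := N.d'_rho (B := A.adj) (SpecialNilAlgebra.isUpper_of_mem_groupG hA)
      hA.2.2.2.1.ne' X hX
    have hdet' : A.adj.detG = 1 := hdet
    rw [hdet', one_pow, one_mul] at h
    exact h
  · rintro ⟨B, h1, h2, h3⟩
    exact SpecialNilAlgebra.IsSelfDualForm.isomorphicEuclidean (B := B) ⟨h1, h2, h3⟩ hV
  · rintro ⟨B, h1, h2, h3⟩ X -
    -- If `S₀ = 0` the correction term vanishes outright, which covers the case excluded from the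
    -- criterion.
    by_cases h0 : Subsingleton S₀
    · exact SpecialNilAlgebra.d_eq_d'_of_subsingleton X
    · exact (SpecialNilAlgebra.IsSelfDualForm.isomorphicEuclidean (B := B) ⟨h1, h2, h3⟩
        fun h => absurd h h0).d_eq_d' X
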